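/- **Conventions.** For a first-order structure $M$, let $D(M^n)$ be the set of subsets of $M^n$ definable in $M$ with parameters. $M$ is *saturated* if for every $A\subseteq M$ with $|A|<|M|$, every set of formulas with parameters from $A$, in finitely many variables, each finite subset of which is realized in $M$, is itself realized in $M$. A function $\#:D(M)\to M$ is *uniformly definable* if for every parameter-free formula $\theta(x,\bar y)$ with $\bar y$ a non-empty tuple there is a parameter-free formula $\theta'(x,\bar y)$ such that for all $\bar a,b$ in $M$: $\#(\theta(\cdot,\bar a))=b$ if and only if $M\models\theta'(b,\bar a)$. Structures $(M,S_1,S_2,\dots,\#)$ with $S_n\subseteq P(M^n)$ and $\#:S_1\to M$ interpret a many-sorted language with object variables, $n$-ary relation variables for each $n\ge 1$ (ranging over $S_n$; the unary ones are called set variables), equality, membership of an $n$-tuple of objects in an $n$-ary relation, and terms $\#X$ for set variables $X$. A formula is *arithmetical* if it has no bound relation variables; a $\Sigma^1_1$-formula (resp. $\Pi^1_1$-formula) is an arithmetical formula preceded by finitely many existential (resp. universal) relation quantifiers of any arities. *Hume's Principle* is $\forall X\,\forall Y\,[\#X=\#Y\leftrightarrow\exists \text{ bijection } f:X\to Y]$,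 with $f$ a binary relation variable; *Basic Law V* is $\forall X\,\forall Y\,[\#X=\#Y\leftrightarrow X=Y]$. Comprehension for a formula $\varphi$ is $\exists R\,\forall\bar n\,[\bar n\in R\leftrightarrow\varphi(\bar n)]$. In all the schemas below, the formulas may contain further free object and relation variables, but $R$ is not free in them. * $\mathsf{\Delta^1_1\text{-}HP_0}$ consists of Hume's Principle and $\Delta^1_1$-comprehension: $[\forall\bar n\,(\varphi(\bar n)\leftrightarrow\psi(\bar n))]\to\exists R\,\forall\bar n\,[\bar n\in R\leftrightarrow\varphi(\bar n)]$ for $\varphi$ a $\Sigma^1_1$-formula and $\psi$ a $\Pi^1_1$-formula. $\mathsf{\Delta^1_1\text{-}BL_0}$ is the same with Basic Law V in place of Hume's Principle. * $\mathsf{\Pi^1_1\text{-}HP_0}$ consists of Hume's Principle and comprehension for $\Pi^1_1$-formulas. * $\mathsf{\Sigma^1_1\text{-}PH_0}$ consists of Hume's Principle, comprehension for arithmetical formulas, and $\Sigma^1_1$-choice: $[\forall\bar n\,\exists P\,\varphi(\bar n,P)]\to\exists R\,\forall\bar n\,\forall P\,[(\forall\bar m\,(\bar m\in P\leftrightarrow\bar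 n\bar m\in R))\to\varphi(\bar n,P)]$ for $\varphi$ a $\Sigma^1_1$-formula. **Theorem.** Let $k$ be an algebraically closed field of characteristic zero that is saturated as a structure in the language of rings. Every $X\in D(k)$ is finite or cofinite, and the function $\#:D(k)\to k$ given by $\#X=|X|$ if $X$ is finite and $\#X=-(|k\setminus X|+1)$ if $X$ is cofinite (integers being regarded as elements of $k$) is uniformly definable. The structure $(k,D(k),D(k^2),\dots,\#)$ is a model of $\mathsf{\Delta^1_1\text{-}HP_0}$, is not a model of $\mathsf{\Sigma^1_1\text{-}PH_0}$, and is not a model of $\mathsf{\Pi^1_1\text{-}HP_0}$. Further, there is no function $\partial:D(k)\to k$ such that $(k,D(k),D(k^2),\dots,\partial)$ is a model of $\mathsf{\Delta^1_1\text{-}BL_0}$. -/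

import Mathlib

universe u v w

/-! ## Definable sets, uniformly definable functions, saturated structures -/

namespace ModelTheoretic

/-- `D(M ^ n)`: the subsets of `M ^ n` definable in `M` with parameters from `M`.
Here `M ^ n` is `Fin n → M`; in particular a subset of `M` is a set of one-element tuples. -/
def definableSets (L : FirstOrder.Language.{u, v}) (M : Type w) [L.Structure M] (n : ℕ) :
    Set (Set (Fin n → M)) :=
  {X | (Set.univ : Set M).Definable L X}

/-- A formula `θ(x, y)` and parameters `a` define a member of `D(M ^ n)`. -/
theorem fiber_mem {L : FirstOrder.Language.{u, v}} {M : Type w} [L.Structure M] {n m : ℕ}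
    (θ : L.Formula (Fin n ⊕ Fin m)) (a : Fin m → M) :
    {x : Fin n → M | θ.Realize (Sum.elim x a)} ∈ definableSets L M n := by
  refine Set.definable_iff_exists_formula_sum.2
    ⟨θ.relabel (Sum.elim Sum.inr fun i => Sum.inl ⟨a i, Set.mem_univ _⟩), ?_⟩
  ext x
  simp only [Set.mem_ofPred_eq, FirstOrder.Language.Formula.realize_relabel]
  refine iff_of_eq (congrArg _ ?_)
  funext i
  cases i <;> rfl

/-- `θ(·, a)` as a member of `D(M ^ n)`. -/
def fiber {L : FirstOrder.Language.{u, v}} {M : Type w} [L.Structure M] {n m : ℕ}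
    (θ : L.Formula (Fin n ⊕ Fin m)) (a : Fin m → M) : definableSets L M n :=
  ⟨{x | θ.Realize (Sum.elim x a)}, fiber_mem θ a⟩

/-- `d : D(M) → M` is uniformly definable: for every parameter-free formula `θ(x, y)`, with `y` a
non-empty tuple of variables, there is a parameter-free formula `θ'(x, y)` such that
`d(θ(·, a)) = b` if and only if `M ⊨ θ'(b, a)`, for all `a` and `b` in `M`. -/
def UniformlyDefinable (L : FirstOrder.Language.{u, v}) (M : Type w) [L.Structure M]
    (d : definableSets L M 1 → M) : Prop :=
  ∀ (m : ℕ) (θ : L.Formula (Fin 1 ⊕ Fin (m + 1))),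
    ∃ θ' : L.Formula (Fin 1 ⊕ Fin (m + 1)),
      ∀ (a : Fin (m + 1) → M) (b : M),
        d (fiber θ a) = b ↔ θ'.Realize (Sum.elim ![b] a)

/-- `M` is saturated: for every `A ⊆ M` with `|A| < |M|`, every finitely realized set of formulas
with parameters from `A`, in finitely many variables, is realized. -/
def Saturated (L : FirstOrder.Language.{u, v}) (M : Type w) [L.Structure M] : Prop :=
  ∀ A : Set M, Cardinal.mk A < Cardinal.mk M →
    ∀ (n : ℕ) (p : Set ((L.withConstants A).Formula (Fin n))),
      (∀ q : Set ((L.withConstants A).Formula (Fin n)), q ⊆ p → q.Finite →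
        ∃ b : Fin n → M, ∀ θ ∈ q, θ.Realize b) →
      ∃ b : Fin n → M, ∀ θ ∈ p, θ.Realize b

end ModelTheoretic

/-! ## The many-sorted language of Hume's Principle and Basic Law V -/

namespace SecondOrder

/-- A structure `(M, S₁, S₂, …, #)` with `Sₙ ⊆ P(M ^ n)` for `n ≥ 1` and `# : S₁ → M`.
The sort of `(n + 1)`-ary relations is `rel n`. -/
structure Struct (M : Type u) where
  rel : (n : ℕ) → Set (Set (Fin (n + 1) → M))
  num : rel 0 → M

/-- Terms of the object sort: object variables, and `#X` for a set variable `X`. -/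
inductive Term where
  | obj (x : ℕ)
  | num (X : ℕ)

/-- Formulas. Object variables are indexed by `ℕ`, and so are the `(n + 1)`-ary relation variables
for each `n`; set variables are the unary relation variables (`n = 0`). -/
inductive Formula where
  | falsum
  | eq (t u : Term)
  | relEq (n : ℕ) (R S : ℕ)
  | mem (n : ℕ) (t : Fin (n + 1) → Term) (R : ℕ)
  | imp (φ ψ : Formula)
  | allObj (x : ℕ) (φ : Formula)
  | exObj (x : ℕ) (φ : Formula)
  | allRel (n : ℕ) (R : ℕ) (φ : Formula)
  | exRel (n : ℕ) (R : ℕ) (φ : Formula)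

namespace Formula

def not (φ : Formula) : Formula := φ.imp falsum

def and (φ ψ : Formula) : Formula := (φ.imp ψ.not).not

def iff (φ ψ : Formula) : Formula := (φ.imp ψ).and (ψ.imp φ)

/-- `∀ x₁ … ∀ xₙ φ`. -/
def allObjs {n : ℕ} (x : Fin n → ℕ) (φ : Formula) : Formula :=
  (List.ofFn x).foldr allObj φ

/-- `(x₁, …, xₙ₊₁) ∈ R` for object variables `xᵢ`. -/
def memVars {n : ℕ} (x : Fin (n + 1) → ℕ) (R : ℕ) : Formula :=
  mem n (fun i => Term.obj (x i)) R

end Formula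

/-- The set variable `Y` occurs in the term. -/
def Term.HasSetVar (Y : ℕ) : Term → Prop
  | .obj _ => False
  | .num X => X = Y

/-- The `(n + 1)`-ary relation variable `R` occurs free in the formula. -/
def Formula.RelFree (n R : ℕ) : Formula → Prop
  | .falsum => False
  | .eq t u => n = 0 ∧ (t.HasSetVar R ∨ u.HasSetVar R)
  | .relEq m S T => m = n ∧ (S = R ∨ T = R)
  | .mem m t S => (m = n ∧ S = R) ∨ (n = 0 ∧ ∃ i, (t i).HasSetVar R)
  | .imp φ ψ => φ.RelFree n R ∨ ψ.RelFree n R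
  | .allObj _ φ => φ.RelFree n R
  | .exObj _ φ => φ.RelFree n R
  | .allRel m S φ => ¬ (m = n ∧ S = R) ∧ φ.RelFree n R
  | .exRel m S φ => ¬ (m = n ∧ S = R) ∧ φ.RelFree n R

/-- Arithmetical formulas: no bound relation variables (free ones are allowed). -/
def Formula.IsArithmetical : Formula → Prop
  | .falsum => True
  | .eq _ _ => True
  | .relEq _ _ _ => True
  | .mem _ _ _ => True
  | .imp φ ψ => φ.IsArithmetical ∧ ψ.IsArithmetical
  | .allObj _ φ => φ.IsArithmetical
  | .exObj _ φ => φ.IsArithmetical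
  | .allRel _ _ _ => False
  | .exRel _ _ _ => False

/-- `Σ¹₁`-formulas: a block of existential relation quantifiers, of any arities, before an
arithmetical formula. -/
inductive Formula.IsSigma11 : Formula → Prop
  | arith {φ : Formula} : φ.IsArithmetical → IsSigma11 φ
  | exRel (n R : ℕ) {φ : Formula} : IsSigma11 φ → IsSigma11 (.exRel n R φ)

/-- `Π¹₁`-formulas: a block of universal relation quantifiers, of any arities, before an
arithmetical formula. -/
inductive Formula.IsPi11 : Formula → Prop
  | arith {φ : Formula} : φ.IsArithmetical → IsPi11 φ
  | allRel (n R : ℕ) {φ : Formula} : IsPi11 φ → IsPi11 (.allRel n R φ)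

/-! ### Satisfaction -/

/-- Values of the object variables and of the relation variables of each arity. -/
structure Assignment {M : Type u} (N : Struct M) where
  obj : ℕ → M
  rel : (n : ℕ) → ℕ → N.rel n

namespace Assignment

variable {M : Type u} {N : Struct M}

def updateObj (s : Assignment N) (x : ℕ) (a : M) : Assignment N where
  obj := Function.update s.obj x a
  rel := s.rel

def updateRel (s : Assignment N) (n R : ℕ) (A : N.rel n) : Assignment N where
  obj := s.obj
  rel := Function.update s.rel n (Function.update (s.rel n) R A)

end Assignment

def Term.eval {M : Type u} {N : Struct M} (s : Assignment N) : Term → M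
  | .obj x => s.obj x
  | .num X => N.num (s.rel 0 X)

def Formula.Sat {M : Type u} {N : Struct M} : Formula → Assignment N → Prop
  | .falsum, _ => False
  | .eq t u, s => t.eval s = u.eval s
  | .relEq n R S, s => s.rel n R = s.rel n S
  | .mem n t R, s => (fun i => (t i).eval s) ∈ (s.rel n R : Set (Fin (n + 1) → M))
  | .imp φ ψ, s => φ.Sat s → ψ.Sat s
  | .allObj x φ, s => ∀ a : M, φ.Sat (s.updateObj x a)
  | .exObj x φ, s => ∃ a : M, φ.Sat (s.updateObj x a)
  | .allRel n R φ, s => ∀ A : N.rel n, φ.Sat (s.updateRel n R A)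
  | .exRel n R φ, s => ∃ A : N.rel n, φ.Sat (s.updateRel n R A)

/-- `N ⊨ T`. Free variables of the axioms are read universally. -/
def Struct.Models {M : Type u} (N : Struct M) (T : Set Formula) : Prop :=
  ∀ φ ∈ T, ∀ s : Assignment N, φ.Sat s

/-! ### The axioms and theories -/

/-- The binary relation variable `f` is a bijection from the set variable `X` to the set
variable `Y`: it relates only members of `X` to members of `Y`, and is total, functional,
injective and surjective. -/
def bijection (f X Y : ℕ) : Formula :=
  let x : ℕ := 0
  let y : ℕ := 1
  let z : ℕ := 2
  let eqv (a b : ℕ) : Formula := .eq (.obj a) (.obj b)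
  let app (a b : ℕ) : Formula := Formula.memVars ![a, b] f
  let elt (a A : ℕ) : Formula := Formula.memVars ![a] A
  ((Formula.allObj x (.allObj y ((app x y).imp ((elt x X).and (elt y Y))))).and
    ((Formula.allObj x ((elt x X).imp (.exObj y (app x y)))).and
      ((Formula.allObj x (.allObj y (.allObj z (((app x y).and (app x z)).imp (eqv y z))))).and
        ((Formula.allObj x (.allObj y (.allObj z (((app x z).and (app y z)).imp (eqv x y))))).and
          (Formula.allObj y ((elt y Y).imp (.exObj x (app x y))))))))

/-- Hume's Principle: `#X = #Y` if and only if there is a bijection `f : X → Y`. -/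
def humesPrinciple : Formula :=
  .allRel 0 0 (.allRel 0 1
    ((Formula.eq (.num 0) (.num 1)).iff (.exRel 1 0 (bijection 0 0 1))))

/-- Basic Law V: `#X = #Y` if and only if `X = Y`. -/
def basicLawV : Formula :=
  .allRel 0 0 (.allRel 0 1 ((Formula.eq (.num 0) (.num 1)).iff (.relEq 0 0 1)))

/-- The formula `∃ R ∀ x ((x ∈ R) ↔ φ(x))`. -/
def comprehension {n : ℕ} (x : Fin (n + 1) → ℕ) (R : ℕ) (φ : Formula) : Formula :=
  .exRel n R (Formula.allObjs x ((Formula.memVars x R).iff φ))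

/-- Comprehension for the formulas in the class `C`. -/
def comprehensionSchema (C : Formula → Prop) : Set Formula :=
  {χ | ∃ (n : ℕ) (x : Fin (n + 1) → ℕ) (R : ℕ) (φ : Formula),
    Function.Injective x ∧ C φ ∧ ¬ φ.RelFree n R ∧ χ = comprehension x R φ}

/-- `Δ¹₁`-comprehension: `(∀ x (φ(x) ↔ ψ(x))) → ∃ R ∀ x ((x ∈ R) ↔ φ(x))` for `φ` a `Σ¹₁`-formula
and `ψ` a `Π¹₁`-formula. -/
def delta11Comprehension : Set Formula :=
  {χ | ∃ (n : ℕ) (x : Fin (n + 1) → ℕ) (R : ℕ) (φ ψ : Formula),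
    Function.Injective x ∧ φ.IsSigma11 ∧ ψ.IsPi11 ∧ ¬ φ.RelFree n R ∧ ¬ ψ.RelFree n R ∧
    χ = (Formula.allObjs x (φ.iff ψ)).imp (comprehension x R φ)}

/-- `Σ¹₁`-choice: `(∀ x ∃ P φ(x, P)) → ∃ R ∀ x ∀ P ((∀ y (y ∈ P ↔ (x, y) ∈ R)) → φ(x, P))` for `φ` a
`Σ¹₁`-formula; `x` and `y` are non-empty tuples of distinct object variables. -/
def sigma11Choice : Set Formula :=
  {χ | ∃ (n m : ℕ) (x : Fin (n + 1) → ℕ) (y : Fin (m + 1) → ℕ) (P R : ℕ) (φ : Formula),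
    Function.Injective (Fin.append x y) ∧ φ.IsSigma11 ∧ ¬ φ.RelFree (n + 1 + m) R ∧
    χ = (Formula.allObjs x (.exRel m P φ)).imp
      (.exRel (n + 1 + m) R (Formula.allObjs x (.allRel m P
        ((Formula.allObjs y ((Formula.memVars y P).iff
          (Formula.memVars (Fin.append (m := n + 1) (n := m + 1) x y) R))).imp φ))))}

/-- `AHP₀`. -/
def AHP : Set Formula := {humesPrinciple} ∪ comprehensionSchema Formula.IsArithmetical

/-- `Δ¹₁-HP₀`. -/
def Delta11HP : Set Formula := {humesPrinciple} ∪ delta11Comprehension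

/-- `Σ¹₁-PH₀`. -/
def Sigma11PH : Set Formula := AHP ∪ sigma11Choice

/-- `Π¹₁-HP₀`. -/
def Pi11HP : Set Formula := {humesPrinciple} ∪ comprehensionSchema Formula.IsPi11

/-- `Δ¹₁-BL₀`. -/
def Delta11BL : Set Formula := {basicLawV} ∪ delta11Comprehension

/-- The structure `(M, D(M), D(M²), …, d)` for `d : D(M) → M`. -/
def definableStruct (L : FirstOrder.Language.{u, v}) (M : Type w) [L.Structure M]
    (d : ModelTheoretic.definableSets L M 1 → M) : Struct M where
  rel n := ModelTheoretic.definableSets L M (n + 1)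
  num := d

end SecondOrder

/-!
A definable subset of `k` is definable over a finite set `A`. If one of its elements is
transcendental over `A`, then so is no element of its complement, because automorphisms fixing `A`
conjugate any two transcendental elements; and by saturation a definable set of algebraic elements
is finite. Hence every definable set is finite or cofinite. Saturation also bounds, for a
parameter-free `θ(x, y)`, the values taken by `#(θ(·, a))`, which makes `#` uniformly definable.

By the Ax-Grothendieck theorem an injective definable map of `k ^ n` into itself is surjective. A
definable bijection between cofinite sets `X` and `Y` with `|k \ Y| > |k \ X|` would extend to an
injective non-surjective definable map, so `#` separates sets that are not in definable bijection,
and Hume's Principle holds. As `#` is uniformly definable, a `Σ¹₁`-formula defines a union of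
definable sets with finitely many parameters altogether, since a quantified relation is a fiber of
one of the parameter-free formulas. When a set and its complement are both such unions, saturation
makes the set definable: this is `Δ¹₁`-comprehension.

`Σ¹₁`-choice applied to `b * b = a` gives a definable square root, and the set of those `v` that are
the chosen root of `v * v` is neither finite nor cofinite, as negation almost exchanges it with its
complement. `Π¹₁`-comprehension makes the range of `#` definable, although it lies between `ℕ` and
`ℤ`. Finally, a function `d` satisfying Basic Law V with `Δ¹₁`-comprehension gives an injective
definable map `a ↦ d {a}` that misses `d ∅`, against the Ax-Grothendieck theorem.
-/

namespace ModelTheoretic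

open Set FirstOrder FirstOrder.Language

section Definability

variable {L : Language} {M : Type*} [L.Structure M] {A : Set M} {α β : Type*}

theorem definable_imp {P Q : (α → M) → Prop} (hP : A.Definable L {v | P v})
    (hQ : A.Definable L {v | Q v}) : A.Definable L {v | P v → Q v} := by
  simpa only [imp_iff_not_or] using! hP.compl.union hQ

theorem definable_iff {P Q : (α → M) → Prop} (hP : A.Definable L {v | P v})
    (hQ : A.Definable L {v | Q v}) : A.Definable L {v | P v ↔ Q v} := by
  simpa only [iff_iff_implies_and_implies] using! (definable_imp hP hQ).inter (definable_imp hQ hP)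

theorem definable_exists {P : (α → M) → M → Prop}
    (hP : A.Definable L {w : Option α → M | P (w ∘ some) (w none)}) :
    A.Definable L {v | ∃ a, P v a} := by
  convert! (hP.preimage_comp
    (fun i => i.elim (Sum.inr ()) Sum.inl : Option α → α ⊕ Unit)).exists_of_finite using 1
  ext v
  exact ⟨fun ⟨a, ha⟩ => ⟨fun _ => a, ha⟩, fun ⟨u, hu⟩ => ⟨u (), hu⟩⟩

theorem definable_forall {P : (α → M) → M → Prop}
    (hP : A.Definable L {w : Option α → M | P (w ∘ some) (w none)}) :
    A.Definable L {v | ∀ a, P v a} := by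
  convert! (definable_exists (P := fun v a => ¬ P v a) hP.compl).compl using 1
  ext v
  simp

theorem definable_of_finite [Finite α] {X : Set (α → M)} (hX : X.Finite) :
    (univ : Set M).Definable L X := by
  have := hX.to_subtype
  have hX' : X = ⋃ x : X, ⋂ i, {v | v i = x.1 i} := by
    ext v
    simp [← funext_iff]
  rw [hX']
  exact definable_iUnion_of_finite fun x => definable_iInter_of_finite fun i =>
    (DefinableFun.proj L).ofPred_eq_const (mem_univ _)

theorem definableFun_comp_right [Finite α] {f : (α → M) → M} (hf : A.DefinableFun L f)
    (e : α → β) : A.DefinableFun L fun v : β → M => f (v ∘ e) :=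
  hf.comp fun _ => DefinableFun.proj L

theorem definableMap_sumElim {γ : Type*} {f : (α → M) → β → M} {g : (α → M) → γ → M}
    (hf : A.DefinableMap L f) (hg : A.DefinableMap L g) :
    A.DefinableMap L fun v => (Sum.elim (f v) (g v) : β ⊕ γ → M)
  | .inl i => hf i
  | .inr i => hg i

theorem definableFun_of_finite_range {ι : Type*} {f : (α → M) → ι} {c : ι → M}
    (hf : ∀ i, A.Definable L {v | f v = i}) (hc : ∀ i, A.DefinableFun L fun _ : Unit → M => c i)
    (hfin : (range f).Finite) : A.DefinableFun L fun v => c (f v) := by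
  have := hfin.to_subtype
  have hgraph : Function.tupleGraph (fun v => c (f v)) =
      ⋃ i : range f, {w | f (w ∘ some) = i} ∩ {w : Option α → M | c i = w none} := by
    ext w
    simp only [Function.tupleGraph, mem_ofPred_eq, mem_iUnion, mem_inter_iff, Subtype.exists,
      mem_range, exists_prop, exists_exists_eq_and]
    exact ⟨fun h => ⟨w ∘ some, rfl, h⟩, fun ⟨_, hi, h⟩ => hi ▸ h⟩
  rw [DefinableFun, hgraph]
  exact definable_iUnion_of_finite fun i =>
    ((hf i).preimage_comp some).inter
      ((definableFun_comp_right (hc i) fun _ => none).ofPred_eq (DefinableFun.proj L))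

theorem comp_mem_of_definable {X : Set (α → M)} (hX : A.Definable L X) (σ : L.Equiv M M)
    (hσ : ∀ a ∈ A, σ a = a) {v : α → M} (hv : v ∈ X) : σ ∘ v ∈ X := by
  obtain ⟨φ, rfl⟩ := definable_iff_exists_formula_sum.1 hX
  have hσv : σ ∘ Sum.elim Subtype.val v = Sum.elim (Subtype.val : A → M) (σ ∘ v) := by
    rw [Sum.comp_elim, show σ ∘ Subtype.val = (Subtype.val : A → M) from funext fun a => hσ a a.2]
  rw [mem_ofPred_eq] at hv ⊢
  exact hσv ▸ (StrongHomClass.realize_formula σ φ).2 hv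

end Definability

section Saturation

variable {L : Language} {M : Type*} [L.Structure M] {A : Set M} {α : Type*} [Finite α]

theorem Saturated.exists_finite_subcover (hM : Saturated L M) (hA : A.Finite) {ι : Type*}
    {S : ι → Set (α → M)} (hS : ∀ i, A.Definable L (S i)) (hcover : ⋃ i, S i = univ) :
    ∃ t : Finset ι, ⋃ i ∈ t, S i = univ := by
  classical
  simp only [eq_univ_iff_forall, mem_iUnion] at hcover ⊢
  rcases finite_or_infinite M with _ | _
  · have := Fintype.ofFinite (α → M)
    choose i hi using hcover
    exact ⟨Finset.univ.image i, fun v => ⟨i v, by simp, hi v⟩⟩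
  by_contra! hfin
  obtain ⟨n, ⟨e⟩⟩ := Finite.exists_equiv_fin α
  choose φ hφ using hS
  have hcard : Cardinal.mk A < Cardinal.mk M :=
    (Cardinal.lt_aleph0_iff_set_finite.2 hA).trans_le (Cardinal.aleph0_le_mk M)
  have hrealize : ∀ i (v : α → M), ((φ i).relabel e).not.Realize (v ∘ e.symm) ↔ v ∉ S i := by
    intro i v
    rw [hφ i, Formula.realize_not, Formula.realize_relabel, Function.comp_assoc,
      e.symm_comp_self, Function.comp_id, mem_ofPred_eq]
  obtain ⟨b, hb⟩ := hM A hcard n (range fun i => ((φ i).relabel e).not) fun q hq hqf => by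
    obtain ⟨t, rfl⟩ := hqf.exists_finset_coe
    obtain ⟨u, -, rfl⟩ := Finset.subset_set_image_iff.1 (image_univ ▸ hq)
    obtain ⟨v, hv⟩ := hfin u
    refine ⟨v ∘ e.symm, fun θ hθ => ?_⟩
    obtain ⟨i, hi, rfl⟩ := Finset.mem_image.1 hθ
    exact (hrealize i v).2 (hv i hi)
  obtain ⟨i, hi⟩ := hcover (b ∘ e)
  refine (hrealize i (b ∘ e)).1 ?_ hi
  rw [Function.comp_assoc, e.self_comp_symm, Function.comp_id]
  exact hb _ ⟨i, rfl⟩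

theorem Saturated.finite_range (hM : Saturated L M) (hA : A.Finite) {ι : Type*} {f : (α → M) → ι}
    (hf : ∀ i, A.Definable L {v | f v = i}) : (range f).Finite := by
  obtain ⟨t, ht⟩ := hM.exists_finite_subcover hA hf
    (eq_univ_of_forall fun v => mem_iUnion.2 ⟨_, rfl⟩)
  refine t.finite_toSet.subset ?_
  rintro _ ⟨v, rfl⟩
  obtain ⟨i, hi, rfl⟩ := mem_iUnion₂.1 (ht ▸ mem_univ v)
  exact hi

end Saturation

section Conjugation

variable {R K : Type*} [CommRing R] [Field K] [IsAlgClosed K] [Algebra R K]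

theorem exists_algEquiv_of_isTranscendenceBasis {ι : Type*} {v w : ι → K}
    (hv : IsTranscendenceBasis R v) (hw : IsTranscendenceBasis R w) :
    ∃ σ : K ≃ₐ[R] K, ∀ i, σ (v i) = w i := by
  let := IsAlgClosed.isAlgClosure_of_transcendence_basis v hv
  let := IsAlgClosed.isAlgClosure_of_transcendence_basis w hw
  let e : Algebra.adjoin R (range v) ≃ₐ[R] Algebra.adjoin R (range w) :=
    hv.1.aevalEquiv.symm.trans hw.1.aevalEquiv
  have he : ∀ i, e ⟨v i, Algebra.subset_adjoin ⟨i, rfl⟩⟩ =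
      ⟨w i, Algebra.subset_adjoin ⟨i, rfl⟩⟩ := fun i => by
    have hvi : hv.1.aevalEquiv (MvPolynomial.X i) = ⟨v i, Algebra.subset_adjoin ⟨i, rfl⟩⟩ :=
      Subtype.ext (by simp)
    exact Subtype.ext (by simp [e, ← hvi])
  let σ := IsAlgClosure.equivOfEquiv K K e.toRingEquiv
  have hσ : ∀ s : Algebra.adjoin R (range v), σ (s : K) = (e s : K) := fun s =>
    IsAlgClosure.equivOfEquiv_algebraMap K K e.toRingEquiv s
  refine ⟨{ σ with
    commutes' := fun r => (hσ (algebraMap R _ r)).trans (by rw [e.commutes]; rfl) }, fun i => ?_⟩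
  exact (hσ ⟨v i, _⟩).trans (congrArg Subtype.val (he i))

theorem exists_algEquiv_of_transcendental {a b : K} (ha : Transcendental R a)
    (hb : Transcendental R b) : ∃ σ : K ≃ₐ[R] K, σ a = b := by
  classical
  have hext : ∀ c : K, Transcendental R c →
      ∃ t : Set K, c ∈ t ∧ IsTranscendenceBasis R ((↑) : t → K) := fun c hc => by
    have hc' : AlgebraicIndepOn R id ({c} : Set K) :=
      (algebraicIndependent_singleton_iff (x := fun i : ({c} : Set K) => (i : K)) ⟨c, rfl⟩).2 hc
    obtain ⟨t, hct, ht⟩ := exists_isTranscendenceBasis_superset hc'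
    exact ⟨t, hct rfl, ht⟩
  obtain ⟨s, has, hs⟩ := hext a ha
  obtain ⟨t, hbt, ht⟩ := hext b hb
  have := (algebraMap R K).domain_nontrivial
  have := (faithfulSMul_iff_algebraMap_injective R K).2 (hs.1.algebraMap_injective)
  obtain ⟨e⟩ := Cardinal.eq.1 (hs.cardinalMk_eq ht)
  let e' : s ≃ t := e.trans (Equiv.swap (e ⟨a, has⟩) ⟨b, hbt⟩)
  obtain ⟨σ, hσ⟩ := exists_algEquiv_of_isTranscendenceBasis hs (ht.comp_equiv e')
  exact ⟨σ, by simpa [e'] using hσ ⟨a, has⟩⟩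

end Conjugation

section RingDefinability

open FirstOrder.Ring

variable {K : Type*} [CommRing K] [CompatibleRing K] {A : Set K} {α : Type*}

theorem definableFun_add {f g : (α → K) → K} (hf : A.DefinableFun ring f)
    (hg : A.DefinableFun ring g) : A.DefinableFun ring fun v => f v + g v := by
  have := (Term.definableFun_realize (M := K) (.var 0 + .var 1 : ring.Term (Fin 2))).of_empty.comp
    (g := fun v => ![f v, g v]) (Fin.forall_fin_two.2 ⟨hf, hg⟩)
  simpa using this

theorem definableFun_mul {f g : (α → K) → K} (hf : A.DefinableFun ring f)
    (hg : A.DefinableFun ring g) : A.DefinableFun ring fun v => f v * g v := by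
  have := (Term.definableFun_realize (M := K) (.var 0 * .var 1 : ring.Term (Fin 2))).of_empty.comp
    (g := fun v => ![f v, g v]) (Fin.forall_fin_two.2 ⟨hf, hg⟩)
  simpa using this

theorem definableFun_neg {f : (α → K) → K} (hf : A.DefinableFun ring f) :
    A.DefinableFun ring fun v => -f v := by
  have := (Term.definableFun_realize (M := K) (-.var () : ring.Term Unit)).of_empty.comp
    (g := fun v _ => f v) (fun _ => hf)
  simpa using this

theorem definableFun_const_of_mem_closure {c : K} (hc : c ∈ Subring.closure A) :
    A.DefinableFun ring fun _ : α → K => c := by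
  induction hc using Subring.closure_induction with
  | mem c hc => exact definableFun_const ring α hc
  | zero => simpa using (Term.definableFun_realize (M := K) (0 : ring.Term α)).of_empty
  | one => simpa using (Term.definableFun_realize (M := K) (1 : ring.Term α)).of_empty
  | add c d _ _ hc hd => exact definableFun_add hc hd
  | neg c _ hc => exact definableFun_neg hc
  | mul c d _ _ hc hd => exact definableFun_mul hc hd

theorem definableFun_aeval (p : Polynomial (Subring.closure A)) (i : α) :
    A.DefinableFun ring fun v : α → K => Polynomial.aeval (v i) p := by
  induction p using Polynomial.induction_on with
  | C c => simpa using! definableFun_const_of_mem_closure c.2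
  | add p q hp hq => simpa using definableFun_add hp hq
  | monomial n c ih =>
    simpa [pow_succ, mul_assoc] using definableFun_mul ih (DefinableFun.proj ring)

end RingDefinability

section Minimality

/-- A structure is minimal if its definable subsets, with parameters, are the finite and the
cofinite ones. -/
def IsMinimal (L : Language) (M : Type*) [L.Structure M] : Prop :=
  ∀ X ∈ definableSets L M 1, X.Finite ∨ Xᶜ.Finite

open FirstOrder.Ring

variable {K : Type*} [Field K] [CompatibleRing K] {A : Set K}

theorem Saturated.finite_of_isAlgebraic (hK : Saturated ring K) (hA : A.Finite)
    {X : Set (Fin 1 → K)} (hX : A.Definable ring X)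
    (halg : ∀ v ∈ X, IsAlgebraic (Subring.closure A) (v 0)) : X.Finite := by
  let roots (p : Polynomial (Subring.closure A)) : Set (Fin 1 → K) :=
    {v | Polynomial.aeval (v 0) p = 0}
  have hroots : ∀ p ≠ 0, (roots p).Finite := fun p hp =>
    (p.rootSet_finite K).preimage (f := fun v : Fin 1 → K => v 0)
      (fun v _ w _ h => funext fun i => Subsingleton.elim 0 i ▸ h) |>.subset
      fun v hv => Polynomial.mem_rootSet.2 ⟨hp, hv⟩
  obtain ⟨t, ht⟩ := hK.exists_finite_subcover hA
    (S := fun p : {p : Polynomial (Subring.closure A) // p ≠ 0} => roots p ∪ Xᶜ)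
    (fun p => ((definableFun_aeval p.1 0).ofPred_eq
      (definableFun_const_of_mem_closure (zero_mem _))).union hX.compl)
    (eq_univ_of_forall fun v => mem_iUnion.2 <| by
      by_cases hv : v ∈ X
      · obtain ⟨p, hp, hpv⟩ := halg v hv
        exact ⟨⟨p, hp⟩, .inl hpv⟩
      · exact ⟨⟨1, one_ne_zero⟩, .inr hv⟩)
  refine (t.finite_toSet.biUnion fun p _ => hroots p p.2).subset fun v hv => ?_
  obtain ⟨p, hp, hvp⟩ := mem_iUnion₂.1 (ht ▸ mem_univ v)
  exact mem_biUnion hp (hvp.resolve_right (not_not.2 hv))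

theorem Saturated.isMinimal [IsAlgClosed K] (hK : Saturated ring K) : IsMinimal ring K := by
  intro X hX
  obtain ⟨A, -, hXA⟩ := definable_iff_finitely_definable.1 hX
  by_cases halg : ∀ v ∈ X, IsAlgebraic (Subring.closure (A : Set K)) (v 0)
  · exact .inl (hK.finite_of_isAlgebraic A.finite_toSet hXA halg)
  push Not at halg
  obtain ⟨v, hvX, hv⟩ := halg
  refine .inr (hK.finite_of_isAlgebraic A.finite_toSet hXA.compl fun w hwX => ?_)
  by_contra hw
  obtain ⟨σ, hσ⟩ := exists_algEquiv_of_transcendental hv hw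
  refine hwX ?_
  have hσv := comp_mem_of_definable hXA (languageEquivEquivRingEquiv.symm σ.toRingEquiv)
    (fun a ha => σ.commutes ⟨a, Subring.subset_closure ha⟩) hvX
  convert! hσv using 1
  exact funext fun i => Subsingleton.elim 0 i ▸ hσ.symm

theorem IsMinimal.exists_mul_self_ne_of_definableFun [Infinite K] (hK : IsMinimal ring K)
    (h2 : (2 : K) ≠ 0) {f : (Fin 1 → K) → K} (hf : (univ : Set K).DefinableFun ring f) :
    ∃ v, f v * f v ≠ v 0 := by
  by_contra! hsqrt
  let S : Set (Fin 1 → K) := {v | f (v * v) = v 0}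
  have hS : (univ : Set K).Definable ring S :=
    (hf.comp fun _ => definableFun_mul (.proj ring) (.proj ring)).ofPred_eq (.proj ring)
  have hcompl : MapsTo (-·) Sᶜ S := fun v hv => by
    change f (-v * -v) = -v 0
    rw [neg_mul_neg]
    exact (mul_self_eq_mul_self_iff.1 (hsqrt (v * v))).resolve_left hv
  have hzero : MapsTo (-·) (S \ {0}) Sᶜ := fun v ⟨hv, hv0⟩ hnv => by
    have hnv' : f (v * v) = -v 0 := by rw [← neg_mul_neg v v]; exact hnv
    have hv' : f (v * v) = v 0 := hv
    have h2v : 2 * v 0 = 0 := by linear_combination hnv' - hv'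
    exact hv0 (funext fun i => Subsingleton.elim 0 i ▸ (mul_eq_zero.1 h2v).resolve_left h2)
  rcases hK S hS with hfin | hfin
  · exact hfin.infinite_compl (hfin.of_injOn hcompl neg_injective.injOn)
  · have hS' := (hfin.of_injOn hzero neg_injective.injOn).of_sdiff (finite_singleton 0)
    exact hS'.infinite_compl hfin

theorem IsMinimal.not_definable_of_range_natCast_subset {L : Language} {K : Type*} [L.Structure K]
    [DivisionRing K] [CharZero K] (hK : IsMinimal L K) {S : Set K}
    (hnat : range ((↑) : ℕ → K) ⊆ S) (hint : S ⊆ range ((↑) : ℤ → K)) :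
    ¬ (univ : Set K).Definable L {v : Fin 1 → K | v 0 ∈ S} := by
  have hinj (c : K) : Function.Injective fun (n : ℕ) (_ : Fin 1) => (n : K) + c := fun m n hmn =>
    Nat.cast_injective (add_right_cancel (congrFun hmn 0))
  intro hS
  rcases hK _ hS with hfin | hfin
  · refine infinite_range_of_injective (hinj 0) (hfin.subset ?_)
    rintro _ ⟨n, rfl⟩
    exact hnat ⟨n, (add_zero _).symm⟩
  · refine infinite_range_of_injective (hinj 2⁻¹) (hfin.subset ?_)
    rintro _ ⟨n, rfl⟩ hn
    obtain ⟨z, hz⟩ := hint hn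
    have hz' : ((z * 2 : ℤ) : K) = ((n * 2 + 1 : ℤ) : K) := by
      push_cast
      rw [hz, add_mul, inv_mul_cancel₀ two_ne_zero]
    have := Int.cast_injective hz'
    omega

end Minimality

section DefinableMap

variable {L : Language} {M : Type*} [L.Structure M] {A : Set M} {α β : Type*} [Finite α] [Finite β]

theorem definableMap_iff_definable_graph {f : (α → M) → β → M} :
    A.DefinableMap L f ↔ A.Definable L {w : α ⊕ β → M | f (w ∘ Sum.inl) = w ∘ Sum.inr} := by
  refine ⟨fun hf => ?_, fun hf i => ?_⟩
  · simp only [funext_iff, ofPred_forall]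
    exact definable_iInter_of_finite fun i =>
      (definableFun_comp_right (hf i) Sum.inl).ofPred_eq (DefinableFun.proj L)
  · have hgraph : Function.tupleGraph (fun v => f v i) = {w : Option α → M |
        ∃ u : β → M, Sum.elim w u ∈
          {w : Option α ⊕ β → M | f (w ∘ Sum.inl ∘ some) = w ∘ Sum.inr} ∩
          {w | w (Sum.inr i) = w (Sum.inl none)}} := by
      ext w
      simp [Function.tupleGraph, ← Function.comp_assoc]
    rw [DefinableFun, hgraph]
    exact ((hf.preimage_comp (Sum.map some id)).inter
      ((DefinableFun.proj L).ofPred_eq (DefinableFun.proj L))).exists_of_finite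

end DefinableMap

section DedekindFinite

/-- A structure is definably Dedekind finite if every injective definable map, with parameters,
of a finite power of its universe into itself is surjective. -/
def IsDefinablyDedekindFinite (L : Language) (M : Type*) [L.Structure M] : Prop :=
  ∀ (n : ℕ) (f : (Fin n → M) → Fin n → M), (univ : Set M).DefinableMap L f →
    Function.Injective f → Function.Surjective f

variable {L : Language}

/-- The sentence saying that, for all values of the parameters, if `θ` defines the graph of an
injective function then this function is surjective. -/
noncomputable def surjectiveOfInjective {m n : ℕ} (θ : L.Formula (Fin m ⊕ (Fin n ⊕ Fin n))) :
    L.Sentence :=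
  let graph {V : Type} (a : Fin m → V) (x y : Fin n → V) : L.Formula V :=
    θ.relabel (Sum.elim a (Sum.elim x y))
  let function : L.Formula (Empty ⊕ Fin m) := Formula.iAlls (Fin n) (Formula.iExsUnique (Fin n)
    (graph (Sum.inl ∘ Sum.inl ∘ Sum.inr) (Sum.inl ∘ Sum.inr) Sum.inr))
  let injective : L.Formula (Empty ⊕ Fin m) :=
    Formula.iAlls (Fin n) (Formula.iAlls (Fin n) (Formula.iAlls (Fin n)
      ((graph (Sum.inl ∘ Sum.inl ∘ Sum.inl ∘ Sum.inr) (Sum.inl ∘ Sum.inl ∘ Sum.inr) Sum.inr).imp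
        ((graph (Sum.inl ∘ Sum.inl ∘ Sum.inl ∘ Sum.inr) (Sum.inl ∘ Sum.inr) Sum.inr).imp
          (Formula.iInf fun i =>
            (Term.var (Sum.inl (Sum.inl (Sum.inr i)))).equal (.var (Sum.inl (Sum.inr i))))))))
  let surjective : L.Formula (Empty ⊕ Fin m) := Formula.iAlls (Fin n) (Formula.iExs (Fin n)
    (graph (Sum.inl ∘ Sum.inl ∘ Sum.inr) Sum.inr (Sum.inl ∘ Sum.inr)))
  Formula.iAlls (Fin m) (function.imp (injective.imp surjective))

variable {M : Type*} [L.Structure M]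

theorem realize_surjectiveOfInjective {m n : ℕ} (θ : L.Formula (Fin m ⊕ (Fin n ⊕ Fin n))) :
    M ⊨ surjectiveOfInjective θ ↔ ∀ (a : Fin m → M) (f : (Fin n → M) → Fin n → M),
      (∀ x y, θ.Realize (Sum.elim a (Sum.elim x y)) ↔ f x = y) → Function.Injective f →
        Function.Surjective f := by
  have hrealize : M ⊨ surjectiveOfInjective θ ↔ ∀ a : Fin m → M,
      (∀ x, ∃! y, θ.Realize (Sum.elim a (Sum.elim x y))) →
      (∀ x x' y, θ.Realize (Sum.elim a (Sum.elim x y)) →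
        θ.Realize (Sum.elim a (Sum.elim x' y)) → x = x') →
      ∀ y, ∃ x, θ.Realize (Sum.elim a (Sum.elim x y)) := by
    simp only [surjectiveOfInjective, Sentence.Realize, Formula.realize_iAlls,
      Formula.realize_imp, Formula.realize_iExsUnique, Formula.realize_relabel,
      Formula.realize_iExs, Formula.realize_iInf, Formula.realize_equal, Term.realize_var,
      Sum.comp_elim, ← Function.comp_assoc, Sum.elim_comp_inl, Sum.elim_comp_inr, Sum.elim_inl,
      Sum.elim_inr, ← funext_iff]
  refine hrealize.trans (forall_congr' fun a => ⟨fun h f hf hinj y => ?_, fun h hfun hinj y => ?_⟩)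
  · simp only [hf] at h
    exact h (fun x => existsUnique_eq') (fun x x' y hx hx' => hinj (hx.trans hx'.symm)) y
  · choose f hf hf' using hfun
    have hgraph : ∀ x y, θ.Realize (Sum.elim a (Sum.elim x y)) ↔ f x = y := fun x y =>
      ⟨fun hxy => (hf' x y hxy).symm, fun hxy => hxy ▸ hf x⟩
    obtain ⟨x, hx⟩ := h f hgraph (fun x x' hxx' => hinj x x' (f x) (hf x) (hxx' ▸ hf x')) y
    exact ⟨x, (hgraph x y).2 hx⟩

theorem isDefinablyDedekindFinite_iff_realize : IsDefinablyDedekindFinite L M ↔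
    ∀ (m n : ℕ) (θ : L.Formula (Fin m ⊕ (Fin n ⊕ Fin n))), M ⊨ surjectiveOfInjective θ := by
  refine ⟨fun h m n θ => (realize_surjectiveOfInjective θ).2 fun a f hf => h n f ?_,
    fun h n f hf => ?_⟩
  · simp only [definableMap_iff_definable_graph, ← hf, Sum.elim_comp_inl_inr]
    refine definable_iff_exists_formula_sum.2
      ⟨θ.relabel (Sum.map (fun i => ⟨a i, mem_univ _⟩) id), ?_⟩
    ext w
    rw [mem_ofPred_eq, mem_ofPred_eq, Formula.realize_relabel, Sum.elim_comp_map,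
      Function.comp_id]
    rfl
  · rw [definableMap_iff_definable_graph] at hf
    obtain ⟨A, -, hA⟩ := definable_iff_finitely_definable.1 hf
    obtain ⟨θ, hθ⟩ := definable_iff_exists_formula_sum.1 hA
    obtain ⟨m, ⟨e⟩⟩ := Finite.exists_equiv_fin A
    refine (realize_surjectiveOfInjective (θ.relabel (Sum.map e id))).1 (h m n _)
      (fun i => e.symm i) f fun x y => ?_
    have hxy := Set.ext_iff.1 hθ (Sum.elim x y)
    simp only [mem_ofPred_eq, Sum.elim_comp_inl, Sum.elim_comp_inr] at hxy
    have he : (fun i => (e.symm i : M)) ∘ e = Subtype.val := funext fun a => by simp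
    rw [Formula.realize_relabel, Sum.elim_comp_map, he, Function.comp_id]
    exact hxy.symm

end DedekindFinite

section AxGrothendieck

open FirstOrder.Ring FirstOrder.Field

theorem exists_pow_prime_pow_eq_self {p : ℕ} [Fact p.Prime] {K : Type*} [Field K]
    [Algebra (ZMod p) K] [Algebra.IsAlgebraic (ZMod p) K] {S : Set K} (hS : S.Finite) :
    ∃ n ≠ 0, ∀ x ∈ S, x ^ p ^ n = x := by
  have := hS.to_subtype
  let E := IntermediateField.adjoin (ZMod p) S
  have : FiniteDimensional (ZMod p) E := IntermediateField.finiteDimensional_adjoin fun x _ =>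
    Algebra.IsIntegral.isIntegral x
  have : Finite E := Module.finite_of_finite (ZMod p)
  have := Fintype.ofFinite E
  have := charP_of_injective_algebraMap (algebraMap (ZMod p) E).injective p
  obtain ⟨n, -, hn⟩ := FiniteField.card E p
  refine ⟨n, n.ne_zero, fun x hx => ?_⟩
  have hxE := FiniteField.pow_card (⟨x, IntermediateField.subset_adjoin _ _ hx⟩ : E)
  rw [hn] at hxE
  exact congrArg Subtype.val hxE

theorem finite_setOf_pow_eq_self {K : Type*} [Field K] {m : ℕ} (hm : 1 < m) :
    {x : K | x ^ m = x}.Finite := by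
  have hne : (Polynomial.X ^ m - Polynomial.X : Polynomial K) ≠ 0 :=
    FiniteField.X_pow_card_sub_X_ne_zero K hm
  refine (Polynomial.rootSet_finite (Polynomial.X ^ m - Polynomial.X : Polynomial K) K).subset
    fun x hx => ?_
  simpa [Polynomial.mem_rootSet, hne, sub_eq_zero] using hx

theorem isDefinablyDedekindFinite_of_isAlgebraic_zmod (p : ℕ) [Fact p.Prime] {K : Type*} [Field K]
    [Algebra (ZMod p) K] [Algebra.IsAlgebraic (ZMod p) K] [CompatibleRing K] :
    IsDefinablyDedekindFinite ring K := by
  intro n f hf hinj y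
  have := charP_of_injective_algebraMap (algebraMap (ZMod p) K).injective p
  have := Algebra.IsAlgebraic.perfectField (ZMod p) (L := K)
  rw [definableMap_iff_definable_graph] at hf
  obtain ⟨A, -, hA⟩ := definable_iff_finitely_definable.1 hf
  obtain ⟨r, hr, hfix⟩ := exists_pow_prime_pow_eq_self (p := p)
    (A.finite_toSet.union (finite_range y))
  let σ := languageEquivEquivRingEquiv.symm (iterateFrobeniusEquiv K p r)
  let F : Set (Fin n → K) := {x | ∀ i, x i ∈ {c : K | c ^ p ^ r = c}}
  have hF : F.Finite := Finite.pi' fun _ =>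
    finite_setOf_pow_eq_self (Nat.one_lt_pow hr (Fact.out : p.Prime).one_lt)
  have hmaps : MapsTo f F F := fun x hx => by
    have hσ := comp_mem_of_definable hA σ (fun a ha => hfix a (.inl ha))
      (v := Sum.elim x (f x)) (by simp)
    simp only [Sum.comp_elim, mem_ofPred_eq, Sum.elim_comp_inl, Sum.elim_comp_inr] at hσ
    rw [show σ ∘ x = x from funext hx] at hσ
    exact fun i => (congrFun hσ i).symm
  obtain ⟨x, -, hx⟩ := ((hF.injOn_iff_bijOn_of_mapsTo hmaps).1 hinj.injOn).surjOn
    (show y ∈ F from fun i => hfix _ (.inr (mem_range_self i)))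
  exact ⟨x, hx⟩

/-- The Ax-Grothendieck theorem for definable maps. -/
theorem isDefinablyDedekindFinite_of_isAlgClosed {K : Type*} [Field K] [IsAlgClosed K]
    [CompatibleRing K] : IsDefinablyDedekindFinite ring K := by
  rw [isDefinablyDedekindFinite_iff_realize]
  intro m n θ
  have hprime : ∀ p : ℕ, p.Prime → Theory.ACF p ⊨ᵇ surjectiveOfInjective θ := fun p hp => by
    have : Fact p.Prime := ⟨hp⟩
    let := compatibleRingOfRing (AlgebraicClosure (ZMod p))
    exact ((ACF_isComplete (.inl hp)).realize_sentence_iff _ (AlgebraicClosure (ZMod p))).1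
      (isDefinablyDedekindFinite_iff_realize.1
        (isDefinablyDedekindFinite_of_isAlgebraic_zmod p) m n θ)
  obtain ⟨p, hp⟩ := CharP.exists K
  rw [(ACF_isComplete (CharP.char_is_prime_or_zero K p)).realize_sentence_iff _ K]
  rcases CharP.char_is_prime_or_zero K p with hp | rfl
  · exact hprime p hp
  · exact ACF_zero_realize_iff_infinite_ACF_prime_realize.2
      ((infinite_univ (α := Nat.Primes)).mono fun p _ => hprime p p.2)

end AxGrothendieck

section Families

variable {L : Language} {M : Type*} [L.Structure M] {A : Set M} {α β γ : Type*}

/-- The sets `X v ⊆ M ^ β`, for `v` in `M ^ α`, form a family that is definable over `A`: the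
relation `x ∈ X v` between `x` and `v` is definable over `A`. -/
def DefinableFamily (L : Language) {M : Type*} [L.Structure M] (A : Set M) {α β : Type*}
    (X : (α → M) → Set (β → M)) : Prop :=
  A.Definable L {w : β ⊕ α → M | w ∘ Sum.inl ∈ X (w ∘ Sum.inr)}

namespace DefinableFamily

variable {X Y : (α → M) → Set (β → M)}

theorem compl (hX : DefinableFamily L A X) : DefinableFamily L A fun v => (X v)ᶜ :=
  Definable.compl hX

theorem mono {B : Set M} (hX : DefinableFamily L A X) (hAB : A ⊆ B) : DefinableFamily L B X :=
  Definable.mono hX hAB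

theorem comp_right (hX : DefinableFamily L A X) (e : α → γ) :
    DefinableFamily L A fun v : γ → M => X (v ∘ e) :=
  Definable.preimage_comp (Sum.map id e) hX

theorem const {S : Set (β → M)} (hS : A.Definable L S) :
    DefinableFamily L A fun _ : α → M => S :=
  hS.preimage_comp Sum.inl

variable [Finite β]

theorem definable_eq (hX : DefinableFamily L A X) (hY : DefinableFamily L A Y) :
    A.Definable L {v | X v = Y v} := by
  simp only [Set.ext_iff]
  exact Definable.forall_of_finite (definable_iff (hX.preimage_comp Sum.swap)
    (hY.preimage_comp Sum.swap))

variable [Finite α]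

theorem definable_mem (hX : DefinableFamily L A X) {f : (γ → M) → β → M}
    (hf : A.DefinableMap L f) {g : (γ → M) → α → M} (hg : A.DefinableMap L g) :
    A.Definable L {v | f v ∈ X (g v)} :=
  Definable.preimage_map (definableMap_sumElim hf hg) hX

end DefinableFamily

theorem definableFamily_fiber {n m : ℕ} (θ : L.Formula (Fin n ⊕ Fin m)) :
    DefinableFamily L A fun a => (fiber θ a).1 := by
  refine (empty_definable_iff.2 ⟨θ, ?_⟩).mono (empty_subset A)
  ext w
  simp only [fiber, mem_ofPred_eq, Sum.elim_comp_inl_inr]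

theorem UniformlyDefinable.definableFun [Finite α] {d : definableSets L M 1 → M}
    (hd : UniformlyDefinable L M d) {X : (α → M) → definableSets L M 1}
    (hX : DefinableFamily L A fun v => (X v).1) : A.DefinableFun L fun v => d (X v) := by
  obtain ⟨B, hBA, hB⟩ := definable_iff_finitely_definable.1 hX
  obtain ⟨φ, hφ⟩ := definable_iff_exists_formula_sum.1 hB
  obtain ⟨m, ⟨e⟩⟩ := Finite.exists_equiv_fin ((B : Set M) ⊕ α)
  let θ : L.Formula (Fin 1 ⊕ Fin (m + 1)) := φ.relabel (Sum.elim
    (fun b => Sum.inr (e (Sum.inl b)).succ)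
    (Sum.elim Sum.inl fun i => Sum.inr (e (Sum.inr i)).succ))
  -- `UniformlyDefinable` asks for a non-empty tuple of parameters, hence the dummy entry `w none`.
  let p (w : Option α → M) : Fin (m + 1) → M :=
    Fin.cons (w none) (Sum.elim Subtype.val (w ∘ some) ∘ e.symm)
  obtain ⟨θ', hθ'⟩ := hd m θ
  have hfiber : ∀ w, fiber θ (p w) = X (w ∘ some) := fun w => Subtype.ext <| Set.ext fun x => by
    refine Iff.trans ?_ (Set.ext_iff.1 hφ (Sum.elim x (w ∘ some))).symm
    rw [fiber, mem_ofPred_eq, Formula.realize_relabel, mem_ofPred_eq]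
    refine iff_of_eq (congrArg _ (funext ?_))
    rintro (b | i | i) <;> simp [p]
  have hgraph : Function.tupleGraph (fun v => d (X v)) =
      {w : Option α → M | θ'.Realize (Sum.elim (fun _ : Fin 1 => w none) (p w))} := by
    ext w
    rw [Function.tupleGraph, mem_ofPred_eq, mem_ofPred_eq, ← hfiber, hθ',
      Matrix.cons_fin_one]
  rw [DefinableFun, hgraph]
  refine Definable.preimage_map (definableMap_sumElim (fun _ => DefinableFun.proj L) ?_)
    ((empty_definable_iff.2 ⟨θ', rfl⟩).mono (empty_subset A))
  refine Fin.cases (DefinableFun.proj L) fun i => ?_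
  rcases hi : e.symm i with b | j
  · simpa [p, hi] using! L.definableFun_const (Option α) (hBA b.2)
  · simpa [p, hi] using! DefinableFun.proj (L := L) (A := A) (i := some j)

end Families

section Numerosity

/-- The number of elements of a finite set, and `-(c + 1)` for an infinite set whose complement
has `c` elements. It is only meaningful for finite and cofinite sets. -/
noncomputable def numerosity {α : Type*} (X : Set α) : ℤ :=
  open Classical in if X.Finite then Int.ofNat X.ncard else Int.negSucc Xᶜ.ncard

theorem numerosity_of_finite {α : Type*} {X : Set α} (hX : X.Finite) : numerosity X = X.ncard :=
  if_pos hX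

theorem numerosity_eq_ofNat_iff {α : Type*} {X : Set α} {n : ℕ} :
    numerosity X = Int.ofNat n ↔ X.encard = n := by
  by_cases hX : X.Finite
  · simp [numerosity, hX, ← hX.cast_ncard_eq]
  · simp [numerosity, hX, Infinite.encard_eq hX]

theorem numerosity_eq_negSucc_iff {α : Type*} [Infinite α] {X : Set α}
    (hX : X.Finite ∨ Xᶜ.Finite) {n : ℕ} :
    numerosity X = Int.negSucc n ↔ Xᶜ.encard = n := by
  by_cases hfin : X.Finite
  · simp [numerosity, hfin, Infinite.encard_eq hfin.infinite_compl]
  · simp [numerosity, hfin, ← (hX.resolve_left hfin).cast_ncard_eq]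

theorem numerosity_of_finite_compl {α : Type*} [Infinite α] {X : Set α} (hX : Xᶜ.Finite) :
    numerosity X = -(Xᶜ.ncard + 1) :=
  (numerosity_eq_negSucc_iff (.inr hX)).2 hX.cast_ncard_eq.symm

theorem exists_numerosity_eq_natCast (L : Language) {M : Type*} [L.Structure M] [Infinite M]
    (n : ℕ) :
    ∃ X : definableSets L M 1, numerosity X.1 = n := by
  obtain ⟨t, ht⟩ := Infinite.exists_subset_card_eq (Fin 1 → M) n
  exact ⟨⟨t, definable_of_finite t.finite_toSet⟩, numerosity_eq_ofNat_iff.2 (by simp [ht])⟩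

theorem natCast_le_encard_iff {α : Type*} {X : Set α} {n : ℕ} :
    (n : ℕ∞) ≤ X.encard ↔ ∃ u : Fin n → α, Function.Injective u ∧ ∀ i, u i ∈ X := by
  refine ⟨fun h => ?_, fun ⟨u, hu, huX⟩ => ?_⟩
  · obtain ⟨t, htX, ht⟩ := exists_subset_encard_eq h
    have := (finite_of_encard_eq_coe ht).to_subtype
    let e : t ≃ Fin n := Finite.equivFinOfCardEq (by simp [ht, ncard])
    exact ⟨fun i => e.symm i, Subtype.val_injective.comp e.symm.injective,
      fun i => htX (e.symm i).2⟩
  · simpa using! ENat.card_le_card_of_injective (f := fun i => (⟨u i, huX i⟩ : X))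
      fun i j hij => hu (congrArg Subtype.val hij)

variable {L : Language} {M : Type*} [L.Structure M] {A : Set M} {α β : Type*} [Finite α] [Finite β]
  {X : (α → M) → Set (β → M)}

theorem DefinableFamily.definable_le_encard (hX : DefinableFamily L A X) (n : ℕ) :
    A.Definable L {v | (n : ℕ∞) ≤ (X v).encard} := by
  have hencard : {v | (n : ℕ∞) ≤ (X v).encard} = {v | ∃ u : Fin n × β → M, Sum.elim v u ∈
      {w : α ⊕ Fin n × β → M | ∀ i j, (∀ b, w (.inr (i, b)) = w (.inr (j, b))) → i = j} ∩
      {w | ∀ i, (fun b => w (.inr (i, b))) ∈ X (w ∘ Sum.inl)}} := by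
    ext v
    rw [mem_ofPred_eq, natCast_le_encard_iff, (Equiv.curry (Fin n) β M).surjective.exists]
    simp only [Function.Injective, funext_iff]
    rfl
  rw [hencard]
  refine Definable.exists_of_finite (.inter ?_ ?_)
  · simp only [ofPred_forall]
    refine definable_iInter_of_finite fun i => definable_iInter_of_finite fun j =>
      definable_imp ?_ ?_
    · simp only [ofPred_forall]
      exact definable_iInter_of_finite fun b =>
          (DefinableFun.proj L).ofPred_eq (DefinableFun.proj L)
    · by_cases hij : i = j
      · simp [hij]
      · simp [hij]
  · simp only [ofPred_forall]
    exact definable_iInter_of_finite fun i => hX.definable_mem (fun _ => DefinableFun.proj L)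
      fun _ => DefinableFun.proj L

theorem DefinableFamily.definable_encard_eq (hX : DefinableFamily L A X) (n : ℕ) :
    A.Definable L {v | (X v).encard = n} := by
  convert! (hX.definable_le_encard n).sdiff (hX.definable_le_encard (n + 1)) using 1
  ext v
  rw [mem_sdiff, mem_ofPred_eq, mem_ofPred_eq, mem_ofPred_eq, not_le, Nat.cast_add, Nat.cast_one,
    ENat.lt_add_one_iff (ENat.natCast_ne_top n), le_antisymm_iff, and_comm]

variable [Infinite M]

theorem DefinableFamily.definable_numerosity_eq [Nonempty β] (hX : DefinableFamily L A X)
    (hfin : ∀ v, (X v).Finite ∨ (X v)ᶜ.Finite) (z : ℤ) :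
    A.Definable L {v | numerosity (X v) = z} := by
  cases z with
  | ofNat n =>
    simp only [numerosity_eq_ofNat_iff]
    exact hX.definable_encard_eq n
  | negSucc n =>
    simp only [numerosity_eq_negSucc_iff (hfin _)]
    exact hX.compl.definable_encard_eq n

theorem Saturated.uniformlyDefinable_numerosity (hM : Saturated L M) (hmin : IsMinimal L M)
    {c : ℤ → M} (hc : ∀ z, (∅ : Set M).DefinableFun L fun _ : Unit → M => c z) :
    UniformlyDefinable L M fun X => c (numerosity X.1) := by
  intro m θ
  have hnum (z : ℤ) := (definableFamily_fiber (A := ∅) θ).definable_numerosity_eq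
    (fun a => hmin _ (fiber θ a).2) z
  obtain ⟨θ', hθ'⟩ := empty_definable_iff.1 <|
    definableFun_of_finite_range hnum hc (hM.finite_range finite_empty hnum)
  refine ⟨θ'.relabel fun i => i.elim (Sum.inl 0) Sum.inr, fun a b => ?_⟩
  rw [Formula.realize_relabel]
  convert! Set.ext_iff.1 hθ' fun i : Option (Fin (m + 1)) => i.elim b a using 2
  exact funext fun i => by cases i <;> rfl

end Numerosity

section DefinableBijections

theorem exists_perm_apply_eq {α : Type*} {X Y : Set α} (hX : X.Finite) (hY : Y.Finite)
    (e : X ≃ Y) : ∃ σ : Equiv.Perm α, {x | σ x ≠ x}.Finite ∧ ∀ x : X, σ x = e x := by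
  classical
  have := hX.to_subtype
  have := (hX.union hY).to_subtype
  obtain ⟨τ, hτ⟩ := Equiv.Perm.exists_extending_pair
    (inclusion (subset_union_left : X ⊆ X ∪ Y)) (inclusion (subset_union_right : Y ⊆ X ∪ Y) ∘ e)
    (inclusion_injective _) ((inclusion_injective _).comp e.injective)
  refine ⟨Equiv.Perm.ofSubtype τ, (hX.union hY).subset fun x hx => ?_, fun x => ?_⟩
  · by_contra hxXY
    exact hx (Equiv.Perm.ofSubtype_apply_of_not_mem τ hxXY)
  · rw [Equiv.Perm.ofSubtype_apply_of_mem τ (.inl x.2)]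
    exact congrArg Subtype.val (hτ x)

theorem exists_perm_image_eq {α : Type*} {X Y : Set α} {n : ℕ} (hX : X.encard = n)
    (hY : Y.encard = n) : ∃ σ : Equiv.Perm α, {x | σ x ≠ x}.Finite ∧ σ '' X = Y := by
  have hXfin := finite_of_encard_eq_coe hX
  have hYfin := finite_of_encard_eq_coe hY
  have := hXfin.to_subtype
  have := hYfin.to_subtype
  obtain ⟨e⟩ := Finite.card_eq.1 (show Nat.card X = Nat.card Y by simp [ncard, hX, hY])
  obtain ⟨σ, hσ, hσe⟩ := exists_perm_apply_eq hXfin hYfin e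
  refine ⟨σ, hσ, ?_⟩
  rw [image_eq_range, funext hσe]
  exact (e.surjective.range_comp Subtype.val).trans Subtype.range_coe

theorem exists_perm_image_eq_of_numerosity_eq {α : Type*} [Infinite α] {X Y : Set α}
    (hX : X.Finite ∨ Xᶜ.Finite) (hY : Y.Finite ∨ Yᶜ.Finite) (h : numerosity X = numerosity Y) :
    ∃ σ : Equiv.Perm α, {x | σ x ≠ x}.Finite ∧ σ '' X = Y := by
  cases hn : numerosity Y with
  | ofNat n =>
    exact exists_perm_image_eq (numerosity_eq_ofNat_iff.1 (h.trans hn))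
      (numerosity_eq_ofNat_iff.1 hn)
  | negSucc n =>
    obtain ⟨σ, hσ, hσX⟩ := exists_perm_image_eq ((numerosity_eq_negSucc_iff hX).1 (h.trans hn))
      ((numerosity_eq_negSucc_iff hY).1 hn)
    exact ⟨σ, hσ, compl_injective (σ.image_compl X ▸ hσX)⟩

/-- The graph of a bijection between subsets of `M ^ α`, as a subset of `M ^ (α ⊕ α)`. -/
def graph {M α : Type*} {X Y : Set (α → M)} (e : X ≃ Y) : Set (α ⊕ α → M) :=
  range fun x : X => Sum.elim x.1 (e x).1

theorem mem_graph {M α : Type*} {X Y : Set (α → M)} {e : X ≃ Y} {w : α ⊕ α → M} :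
    w ∈ graph e ↔ ∃ h : w ∘ Sum.inl ∈ X, (e ⟨w ∘ Sum.inl, h⟩ : α → M) = w ∘ Sum.inr := by
  constructor
  · rintro ⟨x, rfl⟩
    exact ⟨x.2, rfl⟩
  · rintro ⟨h, hw⟩
    exact ⟨⟨_, h⟩, by simp only [hw, Sum.elim_comp_inl_inr]⟩

theorem graph_symm {M α : Type*} {X Y : Set (α → M)} (e : X ≃ Y) :
    graph e.symm = (fun w => w ∘ Sum.swap) ⁻¹' graph e := by
  ext w
  constructor
  · rintro ⟨y, rfl⟩
    exact ⟨e.symm y, by simp only [e.apply_symm_apply, Sum.elim_swap]⟩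
  · rintro ⟨x, hx⟩
    refine ⟨e x, ?_⟩
    dsimp only at hx ⊢
    rw [e.symm_apply_apply, ← Sum.elim_swap, hx, Function.comp_assoc, Sum.swap_swap_eq,
      Function.comp_id]

variable {L : Language} {M : Type*} [L.Structure M]

theorem definableMap_of_finite_ne {α : Type*} [Finite α] {f : (α → M) → α → M}
    (hf : {x | f x ≠ x}.Finite) : (univ : Set M).DefinableMap L f := by
  rw [definableMap_iff_definable_graph]
  have hgraph : {w : α ⊕ α → M | f (w ∘ Sum.inl) = w ∘ Sum.inr} =
      (fun x => Sum.elim x (f x)) '' {x | f x ≠ x} ∪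
        {w | w ∘ Sum.inl = w ∘ Sum.inr} \ {w | w ∘ Sum.inl ∈ {x | f x ≠ x}} := by
    ext w
    simp only [mem_ofPred_eq, mem_union, mem_image, mem_sdiff, not_not]
    constructor
    · intro hw
      by_cases h : f (w ∘ Sum.inl) = w ∘ Sum.inl
      · exact .inr ⟨h ▸ hw, h⟩
      · exact .inl ⟨_, h, by rw [hw, Sum.elim_comp_inl_inr]⟩
    · rintro (⟨x, -, rfl⟩ | ⟨hw, h⟩)
      · rfl
      · rw [h, hw]
  rw [hgraph]
  exact (definable_of_finite (hf.image _)).union <| Definable.sdiff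
    (definableMap_iff_definable_graph.1 fun i => DefinableFun.proj L)
    ((definable_of_finite hf).preimage_comp Sum.inl)

theorem definable_graph_image {α : Type*} [Finite α] {σ : Equiv.Perm (α → M)}
    (hσ : {x | σ x ≠ x}.Finite) {X : Set (α → M)} (hX : (univ : Set M).Definable L X) :
    (univ : Set M).Definable L (graph (σ.image X)) := by
  convert! (hX.preimage_comp Sum.inl).inter
    (definableMap_iff_definable_graph.1 (definableMap_of_finite_ne hσ)) using 1
  ext w
  rw [mem_graph]
  exact ⟨fun ⟨h, hw⟩ => ⟨h, hw⟩, fun ⟨h, hw⟩ => ⟨h, hw⟩⟩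

variable {n : ℕ} {X Y : Set (Fin n → M)}

theorem IsDefinablyDedekindFinite.encard_compl_le [Nonempty M]
    (hM : IsDefinablyDedekindFinite L M)
    (hX : Xᶜ.Finite) {e : X ≃ Y} (he : (univ : Set M).Definable L (graph e)) :
    Yᶜ.encard ≤ Xᶜ.encard := by
  classical
  rcases le_total Yᶜ.encard Xᶜ.encard with hle | hle
  · exact hle
  have := hX.to_subtype
  obtain ⟨i, hi, hi_inj⟩ := hX.exists_injOn_of_encard_le hle
  let F : X ⊕ (Xᶜ : Set (Fin n → M)) → Fin n → M := Sum.elim (fun x => e x) fun x => i x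
  have hF_inj : Function.Injective F := (Subtype.val_injective.comp e.injective).sumElim
    (fun x y hxy => Subtype.ext (hi_inj x.2 y.2 hxy))
    fun x y hxy => hi y.2 (hxy ▸ (e x).2 : i y ∈ Y)
  have hF : (univ : Set M).DefinableMap L (F ∘ (Equiv.Set.sumCompl X).symm) := by
    rw [definableMap_iff_definable_graph]
    convert! he.union (definable_of_finite
      (finite_range fun x : (Xᶜ : Set (Fin n → M)) => Sum.elim x.1 (i x))) using 1
    rw [graph, ← Sum.elim_range, show Sum.elim _ _ = fun x =>
      Sum.elim (Equiv.Set.sumCompl X x) (F x) from funext (by rintro (x | x) <;> rfl)]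
    ext w
    refine ⟨fun hw => ⟨(Equiv.Set.sumCompl X).symm (w ∘ Sum.inl), ?_⟩, ?_⟩
    · dsimp only
      rw [Equiv.apply_symm_apply, show F _ = _ from hw, Sum.elim_comp_inl_inr]
    · rintro ⟨x, rfl⟩
      exact congrArg F (Equiv.symm_apply_apply _ x)
  have hF_surj : Function.Surjective F := by
    simpa using hM n _ hF (hF_inj.comp (Equiv.injective _))
  refine (encard_le_encard fun y hy => ?_).trans (encard_image_le i Xᶜ)
  obtain ⟨x | x, rfl⟩ := hF_surj y
  · exact absurd (e x).2 hy
  · exact ⟨x, x.2, rfl⟩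

theorem numerosity_eq_iff_exists_definable_graph [Infinite M] [NeZero n]
    (hM : IsDefinablyDedekindFinite L M) (hX : (univ : Set M).Definable L X)
    (hXfin : X.Finite ∨ Xᶜ.Finite) (hYfin : Y.Finite ∨ Yᶜ.Finite) :
    numerosity X = numerosity Y ↔
      ∃ e : X ≃ Y, (univ : Set M).Definable L (graph e) := by
  refine ⟨fun h => ?_, fun ⟨e, he⟩ => ?_⟩
  · obtain ⟨σ, hσ, rfl⟩ := exists_perm_image_eq_of_numerosity_eq hXfin hYfin h
    exact ⟨σ.image X, definable_graph_image hσ hX⟩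
  have he_symm : (univ : Set M).Definable L (graph e.symm) := graph_symm e ▸ he.preimage_comp _
  cases hn : numerosity Y with
  | ofNat m =>
    exact numerosity_eq_ofNat_iff.2 ((encard_congr e).trans (numerosity_eq_ofNat_iff.1 hn))
  | negSucc m =>
    have hY := (numerosity_eq_negSucc_iff hYfin).1 hn
    have hYc := finite_of_encard_eq_coe hY
    have hle := hM.encard_compl_le hYc he_symm
    have hXc := finite_of_encard_le_coe (hle.trans_eq hY)
    exact (numerosity_eq_negSucc_iff hXfin).2 (hle.antisymm (hM.encard_compl_le hXc he) |>.trans hY)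

end DefinableBijections

section UnionOfDefinable

variable {L : Language} {M : Type*} [L.Structure M] {A : Set M} {α β : Type*}

theorem exists_fiber_eq {n : ℕ} (B : definableSets L M n) :
    ∃ (m : ℕ) (θ : L.Formula (Fin n ⊕ Fin m)) (a : Fin m → M), fiber θ a = B := by
  obtain ⟨P, -, hP⟩ := definable_iff_finitely_definable.1 B.2
  obtain ⟨θ, hθ⟩ := definable_iff_exists_formula_sum.1 hP
  obtain ⟨m, ⟨e⟩⟩ := Finite.exists_equiv_fin P
  refine ⟨m, θ.relabel (Sum.elim (Sum.inr ∘ e) Sum.inl), fun i => (e.symm i : M),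
    Subtype.ext (Eq.trans ?_ hθ.symm)⟩
  ext v
  rw [fiber, mem_ofPred_eq, mem_ofPred_eq, Formula.realize_relabel]
  refine iff_of_eq (congrArg _ (funext ?_))
  rintro (i | i) <;> simp

/-- A union, possibly infinite, of sets definable over `A`. Over a saturated structure these play
the role of the sets given by `Σ¹₁`-formulas. -/
def IsUnionOfDefinable (L : Language) {M : Type*} [L.Structure M] (A : Set M) {α : Type*}
    (S : Set (α → M)) : Prop :=
  ∀ v ∈ S, ∃ T ⊆ S, A.Definable L T ∧ v ∈ T

theorem IsUnionOfDefinable.of_definable {S : Set (α → M)} (hS : A.Definable L S) :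
    IsUnionOfDefinable L A S :=
  fun _ hv => ⟨S, Subset.rfl, hS, hv⟩

theorem IsUnionOfDefinable.mono {B : Set M} {S : Set (α → M)} (hS : IsUnionOfDefinable L A S)
    (hAB : A ⊆ B) : IsUnionOfDefinable L B S :=
  fun v hv => (hS v hv).imp fun _ ⟨hTS, hT, hvT⟩ => ⟨hTS, hT.mono hAB, hvT⟩

theorem IsUnionOfDefinable.image_comp_inl [Finite β] {S : Set (α ⊕ β → M)}
    (hS : IsUnionOfDefinable L A S) : IsUnionOfDefinable L A {v | ∃ u, Sum.elim v u ∈ S} := by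
  rintro v ⟨u, hu⟩
  obtain ⟨T, hTS, hT, huT⟩ := hS _ hu
  exact ⟨{v | ∃ u, Sum.elim v u ∈ T}, fun v hv => hv.imp fun u hu => hTS hu,
    hT.exists_of_finite, u, huT⟩

theorem Saturated.definable_of_isUnionOfDefinable [Finite α] (hM : Saturated L M) (hA : A.Finite)
    {S : Set (α → M)} (hS : IsUnionOfDefinable L A S) (hSc : IsUnionOfDefinable L A Sᶜ) :
    A.Definable L S := by
  have hT (v : α → M) : ∃ T, A.Definable L T ∧ v ∈ T ∧ (T ⊆ S ∨ T ⊆ Sᶜ) := by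
    by_cases hv : v ∈ S
    · obtain ⟨T, hTS, hT, hvT⟩ := hS v hv
      exact ⟨T, hT, hvT, .inl hTS⟩
    · obtain ⟨T, hTS, hT, hvT⟩ := hSc v hv
      exact ⟨T, hT, hvT, .inr hTS⟩
  choose T hT hvT hTS using hT
  obtain ⟨t, ht⟩ := hM.exists_finite_subcover hA hT
    (eq_univ_of_forall fun v => mem_iUnion.2 ⟨v, hvT v⟩)
  have hS_eq : S = ⋃ v : {v : t // T v ⊆ S}, T v.1 := by
    refine subset_antisymm (fun v hv => ?_) (iUnion_subset fun v => v.2)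
    obtain ⟨u, hu, hvu⟩ := mem_iUnion₂.1 (ht ▸ mem_univ v)
    exact mem_iUnion.2 ⟨⟨⟨u, hu⟩, (hTS u).resolve_right fun h => h hvu hv⟩, hvu⟩
  rw [hS_eq]
  exact definable_iUnion_of_finite fun v => hT v.1

end UnionOfDefinable

end ModelTheoretic

namespace SecondOrder

open Set ModelTheoretic FirstOrder FirstOrder.Language

section Satisfaction

variable {M : Type*} {N : Struct M}

namespace Assignment

theorem ext {s t : Assignment N} (h : s.obj = t.obj) (h' : ∀ n R, s.rel n R = t.rel n R) :
    s = t := by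
  obtain ⟨so, sr⟩ := s
  obtain ⟨uo, tr⟩ := t
  obtain rfl : so = uo := h
  obtain rfl : sr = tr := funext fun n => funext fun R => h' n R
  rfl

/-- The simultaneous update giving the variables `x i` the values `v i`. -/
noncomputable def updateObjs {n : ℕ} (s : Assignment N) (x : Fin n → ℕ) (v : Fin n → M) :
    Assignment N where
  obj := Function.extend x v s.obj
  rel := s.rel

theorem updateObjs_obj_apply {n : ℕ} (s : Assignment N) {x : Fin n → ℕ}
    (hx : Function.Injective x) (v : Fin n → M) (i : Fin n) :
    (s.updateObjs x v).obj (x i) = v i :=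
  hx.extend_apply v s.obj i

theorem updateObjs_obj_comp {n : ℕ} (s : Assignment N) {x : Fin n → ℕ}
    (hx : Function.Injective x) (v : Fin n → M) : (s.updateObjs x v).obj ∘ x = v :=
  funext (s.updateObjs_obj_apply hx v)

theorem updateObjs_zero (s : Assignment N) (x : Fin 0 → ℕ) (v : Fin 0 → M) :
    s.updateObjs x v = s :=
  ext (funext fun _ => Function.extend_apply' _ _ _ fun ⟨i, _⟩ => i.elim0) fun _ _ => rfl

theorem updateObjs_cons {n : ℕ} (s : Assignment N) {x : Fin (n + 1) → ℕ}
    (hx : Function.Injective x) (a : M) (v : Fin n → M) :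
    s.updateObjs x (Fin.cons a v) =
      (s.updateObj (x 0) a).updateObjs (fun i : Fin n => x i.succ) v := by
  have htail : Function.Injective fun i : Fin n => x i.succ := hx.comp (Fin.succ_injective n)
  refine ext (funext fun y => ?_) fun _ _ => rfl
  dsimp only [updateObjs, updateObj]
  by_cases hy : ∃ i, x i = y
  · obtain ⟨i, rfl⟩ := hy
    rw [hx.extend_apply]
    cases i using Fin.cases with
    | zero =>
      rw [Function.extend_apply' _ _ _ fun ⟨i, hi⟩ => Fin.succ_ne_zero i (hx hi),
        Function.update_self, Fin.cons_zero]
    | succ i => exact (htail.extend_apply v _ i).symm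
  · rw [Function.extend_apply' _ _ _ hy, Function.extend_apply' _ _ _ fun ⟨i, hi⟩ => hy ⟨_, hi⟩,
      Function.update_of_ne fun h0 => hy ⟨0, h0.symm⟩]

theorem updateObjs_append (s : Assignment N) {n m : ℕ} {x : Fin n → ℕ} {y : Fin m → ℕ}
    (hxy : Function.Injective (Fin.append x y)) (v : Fin n → M) (w : Fin m → M) :
    (s.updateObjs x v).updateObjs y w = s.updateObjs (Fin.append x y) (Fin.append v w) := by
  obtain ⟨hx, hy, hdisj⟩ := Fin.append_injective_iff.1 hxy
  refine ext (funext fun z => ?_) fun _ _ => rfl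
  by_cases hz : ∃ i, Fin.append x y i = z
  · obtain ⟨i, rfl⟩ := hz
    rw [updateObjs_obj_apply _ hxy]
    refine Fin.addCases (fun i => ?_) (fun i => ?_) i
    · rw [Fin.append_left, Fin.append_left]
      exact (Function.extend_apply' _ _ _ fun ⟨j, hj⟩ => hdisj i j hj.symm).trans
        (hx.extend_apply _ _ _)
    · rw [Fin.append_right, Fin.append_right, updateObjs_obj_apply _ hy]
  · have hxz : ¬ ∃ i, x i = z := fun ⟨i, hi⟩ => hz ⟨i.castAdd m, (Fin.append_left x y i).trans hi⟩
    have hyz : ¬ ∃ i, y i = z := fun ⟨i, hi⟩ => hz ⟨i.natAdd n, (Fin.append_right x y i).trans hi⟩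
    exact (Function.extend_apply' _ _ _ hyz).trans
      ((Function.extend_apply' _ _ _ hxz).trans (Function.extend_apply' _ _ _ hz).symm)

theorem updateRel_rel_self (s : Assignment N) (n R : ℕ) (B : N.rel n) :
    (s.updateRel n R B).rel n R = B := by
  simp [updateRel]

theorem updateRel_rel_of_ne (s : Assignment N) {n R m S : ℕ} (B : N.rel n)
    (h : ¬ (n = m ∧ R = S)) : (s.updateRel n R B).rel m S = s.rel m S := by
  by_cases hm : n = m
  · subst hm
    simp [updateRel, Function.update_of_ne fun hS => h ⟨rfl, Eq.symm hS⟩]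
  · simp [updateRel, Function.update_of_ne (Ne.symm hm)]

end Assignment

theorem Term.eval_congr {s t : Assignment N} (hobj : s.obj = t.obj) :
    ∀ {u : Term}, (∀ R, u.HasSetVar R → s.rel 0 R = t.rel 0 R) → u.eval s = u.eval t
  | .obj x, _ => congrFun hobj x
  | .num X, hrel => congrArg N.num (hrel X rfl)

namespace Formula

theorem sat_and (φ ψ : Formula) (s : Assignment N) :
    (φ.and ψ).Sat s ↔ φ.Sat s ∧ ψ.Sat s := by
  change ¬ (φ.Sat s → ¬ ψ.Sat s) ↔ _
  tauto

theorem sat_iff (φ ψ : Formula) (s : Assignment N) :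
    (φ.iff ψ).Sat s ↔ (φ.Sat s ↔ ψ.Sat s) :=
  (sat_and (φ.imp ψ) (ψ.imp φ) s).trans iff_iff_implies_and_implies.symm

theorem sat_memVars {n : ℕ} (x : Fin (n + 1) → ℕ) (R : ℕ) (s : Assignment N) :
    (memVars x R).Sat s ↔ s.obj ∘ x ∈ (s.rel n R).1 :=
  Iff.rfl

theorem sat_memVars_one (x R : ℕ) (s : Assignment N) :
    (memVars ![x] R).Sat s ↔ ![s.obj x] ∈ (s.rel 0 R).1 := by
  rw [sat_memVars]
  congr! 1
  exact (FinVec.map_eq s.obj ![x]).symm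

theorem sat_memVars_two (x y R : ℕ) (s : Assignment N) :
    (memVars ![x, y] R).Sat s ↔ ![s.obj x, s.obj y] ∈ (s.rel 1 R).1 := by
  rw [sat_memVars]
  congr! 1
  exact (FinVec.map_eq s.obj ![x, y]).symm

theorem sat_allObjs {n : ℕ} {x : Fin n → ℕ} (hx : Function.Injective x) (φ : Formula)
    (s : Assignment N) : (allObjs x φ).Sat s ↔ ∀ v, φ.Sat (s.updateObjs x v) := by
  induction n generalizing s with
  | zero => simp only [s.updateObjs_zero, forall_const, allObjs, List.ofFn_zero, List.foldr_nil]
  | succ n ih =>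
    have hsucc : allObjs x φ = (allObjs (fun i : Fin n => x i.succ) φ).allObj (x 0) := by
      simp only [allObjs, List.ofFn_succ, List.foldr_cons]
    simp only [hsucc, Sat, ih (x := fun i => x i.succ) (hx.comp (Fin.succ_injective n)),
      Fin.forall_fin_succ_pi, s.updateObjs_cons hx]

theorem sat_congr (φ : Formula) {s t : Assignment N} (hobj : s.obj = t.obj)
    (hrel : ∀ n R, φ.RelFree n R → s.rel n R = t.rel n R) : φ.Sat s ↔ φ.Sat t := by
  have hupdate {m S : ℕ} {φ : Formula} {s t : Assignment N} (B : N.rel m)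
      (hrel : ∀ n R, ¬ (m = n ∧ S = R) ∧ φ.RelFree n R → s.rel n R = t.rel n R) (n R : ℕ)
      (h : φ.RelFree n R) : (s.updateRel m S B).rel n R = (t.updateRel m S B).rel n R := by
    by_cases hS : m = n ∧ S = R
    · obtain ⟨rfl, rfl⟩ := hS
      rw [Assignment.updateRel_rel_self, Assignment.updateRel_rel_self]
    · rw [Assignment.updateRel_rel_of_ne _ _ hS, Assignment.updateRel_rel_of_ne _ _ hS]
      exact hrel n R ⟨hS, h⟩
  induction φ generalizing s t with
  | falsum => rfl
  | eq u v =>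
    rw [Sat, Sat, Term.eval_congr hobj fun R h => hrel 0 R ⟨rfl, Or.inl h⟩,
      Term.eval_congr hobj fun R h => hrel 0 R ⟨rfl, Or.inr h⟩]
  | relEq n R S =>
    rw [Sat, Sat, hrel n R ⟨rfl, Or.inl rfl⟩, hrel n S ⟨rfl, Or.inr rfl⟩]
  | mem n u R =>
    rw [Sat, Sat, hrel n R (Or.inl ⟨rfl, rfl⟩), funext fun i =>
      Term.eval_congr hobj fun R h => hrel 0 R (Or.inr ⟨rfl, i, h⟩)]
  | imp φ ψ hφ hψ =>
    exact imp_congr (hφ hobj fun n R h => hrel n R (Or.inl h))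
      (hψ hobj fun n R h => hrel n R (Or.inr h))
  | allObj x φ ih =>
    exact forall_congr' fun a => ih (by simp only [Assignment.updateObj, hobj]) hrel
  | exObj x φ ih =>
    exact exists_congr fun a => ih (by simp only [Assignment.updateObj, hobj]) hrel
  | allRel m S φ ih => exact forall_congr' fun B => ih hobj (hupdate B hrel)
  | exRel m S φ ih => exact exists_congr fun B => ih hobj (hupdate B hrel)

theorem sat_updateRel_of_not_relFree {φ : Formula} {n R : ℕ} (h : ¬ φ.RelFree n R)
    (s : Assignment N) (B : N.rel n) : φ.Sat (s.updateRel n R B) ↔ φ.Sat s := by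
  refine φ.sat_congr rfl fun m S hS => Assignment.updateRel_rel_of_ne _ _ ?_
  rintro ⟨rfl, rfl⟩
  exact h hS

theorem sat_comprehension {n : ℕ} {x : Fin (n + 1) → ℕ} (hx : Function.Injective x) {R : ℕ}
    {φ : Formula} (hφ : ¬ φ.RelFree n R) (s : Assignment N) :
    (comprehension x R φ).Sat s ↔ {v | φ.Sat (s.updateObjs x v)} ∈ N.rel n := by
  have hsat (B : N.rel n) : (allObjs x ((memVars x R).iff φ)).Sat (s.updateRel n R B) ↔
      B.1 = {v | φ.Sat (s.updateObjs x v)} := by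
    rw [sat_allObjs hx, Set.ext_iff]
    refine forall_congr' fun v => ?_
    change ((memVars x R).iff φ).Sat ((s.updateObjs x v).updateRel n R B) ↔ _
    rw [sat_iff, sat_updateRel_of_not_relFree hφ, sat_memVars, Assignment.updateRel_rel_self]
    change ((s.updateObjs x v).obj ∘ x ∈ B.1 ↔ _) ↔ _
    rw [s.updateObjs_obj_comp hx, mem_ofPred_eq]
  exact ⟨fun ⟨B, hB⟩ => (hsat B).1 hB ▸ B.2, fun hB => ⟨⟨_, hB⟩, (hsat ⟨_, hB⟩).2 rfl⟩⟩

end Formula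

theorem exists_equiv_iff_forall {α β : Type*} {r : α → β → Prop} {X : Set α} {Y : Set β} :
    (∃ e : X ≃ Y, ∀ x y, r x y ↔ ∃ h : x ∈ X, (e ⟨x, h⟩ : β) = y) ↔
      (∀ x y, r x y → x ∈ X ∧ y ∈ Y) ∧ (∀ x ∈ X, ∃ y, r x y) ∧
        (∀ x y z, r x y ∧ r x z → y = z) ∧ (∀ x y z, r x z ∧ r y z → x = y) ∧
          ∀ y ∈ Y, ∃ x, r x y := by
  constructor
  · rintro ⟨e, he⟩
    simp only [he]
    refine ⟨?_, fun x hx => ⟨_, hx, rfl⟩, ?_, ?_, fun y hy => ?_⟩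
    · rintro x _ ⟨hx, rfl⟩
      exact ⟨hx, (e ⟨x, hx⟩).2⟩
    · rintro x _ _ ⟨⟨_, rfl⟩, ⟨_, rfl⟩⟩
      rfl
    · rintro x y _ ⟨⟨hx, rfl⟩, ⟨hy, hxy⟩⟩
      exact congrArg Subtype.val (e.injective (Subtype.ext hxy)).symm
    · exact ⟨e.symm ⟨y, hy⟩, (e.symm ⟨y, hy⟩).2, by simp⟩
  · rintro ⟨hmem, htotal, hfun, hinj, hsurj⟩
    choose f hf using fun x : X => htotal x x.2
    let g (x : X) : Y := ⟨f x, (hmem _ _ (hf x)).2⟩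
    have hg : g.Bijective := by
      refine ⟨fun x y hxy => Subtype.ext (hinj _ _ _ ⟨hf x, ?_⟩), fun y => ?_⟩
      · rw [show f x = f y from congrArg Subtype.val hxy]
        exact hf y
      · obtain ⟨x, hx⟩ := hsurj y y.2
        exact ⟨⟨x, (hmem _ _ hx).1⟩, Subtype.ext (hfun _ _ _ ⟨hf _, hx⟩)⟩
    refine ⟨Equiv.ofBijective g hg, fun x y =>
      ⟨fun hxy => ⟨(hmem _ _ hxy).1, hfun _ _ _ ⟨hf _, hxy⟩⟩, ?_⟩⟩
    rintro ⟨hx, rfl⟩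
    exact hf ⟨x, hx⟩

theorem forall_fin_one_pi {p : (Fin 1 → M) → Prop} : (∀ v, p v) ↔ ∀ a, p ![a] :=
  Fin.forall_fin_succ_pi.trans (forall_congr' fun _ => Fin.forall_fin_zero_pi)

theorem exists_fin_one_pi {p : (Fin 1 → M) → Prop} : (∃ v, p v) ↔ ∃ a, p ![a] :=
  Fin.exists_fin_succ_pi.trans (exists_congr fun _ => Fin.exists_fin_zero_pi)

theorem sat_bijection (s : Assignment N) (f X Y : ℕ) : (bijection f X Y).Sat s ↔
    ∃ e : (s.rel 0 X).1 ≃ (s.rel 0 Y).1,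
      {w : Fin 1 ⊕ Fin 1 → M | ![w (.inl 0), w (.inr 0)] ∈ (s.rel 1 f).1} = graph e := by
  have hgraph (e : (s.rel 0 X).1 ≃ (s.rel 0 Y).1) :
      {w : Fin 1 ⊕ Fin 1 → M | ![w (.inl 0), w (.inr 0)] ∈ (s.rel 1 f).1} = graph e ↔
        ∀ x y : Fin 1 → M, ![x 0, y 0] ∈ (s.rel 1 f).1 ↔
          ∃ h : x ∈ (s.rel 0 X).1, (e ⟨x, h⟩ : Fin 1 → M) = y := by
    simp only [Set.ext_iff, mem_graph, mem_ofPred_eq]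
    exact ⟨fun h x y => h (Sum.elim x y), fun h w => h (w ∘ Sum.inl) (w ∘ Sum.inr)⟩
  rw [exists_congr hgraph, exists_equiv_iff_forall]
  simp only [forall_fin_one_pi (M := M), exists_fin_one_pi (M := M), Matrix.cons_val_fin_one]
  simp only [bijection, Formula.sat_and, Formula.Sat, Formula.sat_memVars_one,
    Formula.sat_memVars_two, Term.eval, Assignment.updateObj]
  simp [Function.update_self]

end Satisfaction

section Hume

variable {L : Language} {M : Type*} [L.Structure M]

theorem exists_definableSets_eq_graph_iff {X Y : Set (Fin 1 → M)} {e : X ≃ Y} :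
    (∃ G : definableSets L M 2,
        {w : Fin 1 ⊕ Fin 1 → M | ![w (.inl 0), w (.inr 0)] ∈ G.1} = graph e) ↔
      (univ : Set M).Definable L (graph e) := by
  constructor
  · rintro ⟨G, hG⟩
    have hcomp (w : Fin 1 ⊕ Fin 1 → M) : ![w (.inl 0), w (.inr 0)] = w ∘ ![Sum.inl 0, Sum.inr 0] :=
      FinVec.map_eq w ![Sum.inl 0, Sum.inr 0]
    simp only [← hG, hcomp]
    exact Definable.preimage_comp ![Sum.inl 0, Sum.inr 0] G.2
  · intro he
    refine ⟨⟨_, he.preimage_comp (Sum.elim (fun _ => 0) fun _ => 1)⟩, ?_⟩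
    ext w
    refine iff_of_eq (congrArg (· ∈ graph e) (funext ?_))
    rintro (i | i) <;> fin_cases i <;> rfl

theorem models_humesPrinciple [Infinite M] (hmin : IsMinimal L M)
    (hM : IsDefinablyDedekindFinite L M) {c : ℤ → M} (hc : Function.Injective c) :
    (definableStruct L M fun X => c (numerosity X.1)).Models {humesPrinciple} := by
  rintro _ rfl s X Y
  rw [Formula.sat_iff]
  calc c (numerosity X.1) = c (numerosity Y.1)
      ↔ numerosity X.1 = numerosity Y.1 := hc.eq_iff
    _ ↔ ∃ e : X.1 ≃ Y.1, (univ : Set M).Definable L (graph e) :=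
        numerosity_eq_iff_exists_definable_graph hM X.2 (hmin _ X.2) (hmin _ Y.2)
    _ ↔ ∃ (e : X.1 ≃ Y.1) (G : definableSets L M 2),
          {w : Fin 1 ⊕ Fin 1 → M | ![w (.inl 0), w (.inr 0)] ∈ G.1} = graph e :=
        exists_congr fun e => exists_definableSets_eq_graph_iff.symm
    _ ↔ _ := exists_comm.trans <| exists_congr fun G => (sat_bijection
        (((s.updateRel 0 0 X).updateRel 0 1 Y).updateRel 1 0 G) 0 0 1).symm

end Hume

section DefinableAssignments

variable {L : Language} {M : Type*} [L.Structure M] {d : definableSets L M 1 → M}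
  {P : ℕ → Set M} {Q : ℕ → ℕ → Set M} {α β : Type}

/-- In the assignments `s v`, for `v` in `M ^ α`, the value of the object variable `x` is definable
over `P x` as a function of `v`, and that of the `(n + 1)`-ary relation variable `R` is a family
definable over `Q n R`. The sets depend on the variable because a formula, with its finitely many
free variables, then needs only finitely many parameters even if their union is infinite. -/
structure DefinableAssignments (P : ℕ → Set M) (Q : ℕ → ℕ → Set M)
    (s : (α → M) → Assignment (definableStruct L M d)) : Prop where
  obj (x : ℕ) : (P x).DefinableFun L fun v => (s v).obj x
  rel (n R : ℕ) : DefinableFamily L (Q n R) fun v => ((s v).rel n R).1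

namespace DefinableAssignments

variable {s : (α → M) → Assignment (definableStruct L M d)}

theorem comp_right [Finite α] (hs : DefinableAssignments P Q s) (e : α → β) :
    DefinableAssignments P Q fun v : β → M => s (v ∘ e) where
  obj x := definableFun_comp_right (hs.obj x) e
  rel n R := (hs.rel n R).comp_right e

theorem updateObj (hs : DefinableAssignments P Q s) (x : ℕ) (i : α) :
    DefinableAssignments P Q fun v => (s v).updateObj x (v i) where
  obj y := by
    by_cases hxy : y = x
    · subst hxy
      simpa only [Assignment.updateObj, Function.update_self] using DefinableFun.proj L
    · simpa only [Assignment.updateObj, Function.update_of_ne hxy] using hs.obj y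
  rel := hs.rel

theorem updateRel (hs : DefinableAssignments P Q s) (n R : ℕ)
    {X : (α → M) → (definableStruct L M d).rel n}
    (hX : DefinableFamily L (Q n R) fun v => (X v).1) :
    DefinableAssignments P Q fun v => (s v).updateRel n R (X v) where
  obj := hs.obj
  rel m S := by
    by_cases h : n = m ∧ R = S
    · obtain ⟨rfl, rfl⟩ := h
      simpa only [Assignment.updateRel_rel_self] using hX
    · simpa only [Assignment.updateRel_rel_of_ne _ _ h] using hs.rel m S

end DefinableAssignments

theorem exists_definableAssignments_updateObjs (s : Assignment (definableStruct L M d)) {n : ℕ}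
    {x : Fin n → ℕ} (hx : Function.Injective x) :
    ∃ (P : ℕ → Set M) (Q : ℕ → ℕ → Set M), (∀ y, (P y).Finite) ∧ (∀ m R, (Q m R).Finite) ∧
      DefinableAssignments P Q fun v => s.updateObjs x v := by
  choose Q hQ using fun n R => definable_iff_finitely_definable.1 (s.rel n R).2
  refine ⟨fun y => {s.obj y}, fun m R => Q m R, fun _ => finite_singleton _,
    fun m R => (Q m R).finite_toSet, fun y => ?_, fun m R => .const (hQ m R).2⟩
  by_cases hy : ∃ i, x i = y
  · obtain ⟨i, rfl⟩ := hy
    simpa only [Assignment.updateObjs, hx.extend_apply] using DefinableFun.proj L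
  · simp only [Assignment.updateObjs, Function.extend_apply' _ _ _ hy]
    exact L.definableFun_const _ rfl

theorem isUnionOfDefinable_exists_rel {A : Set M} {p : Assignment (definableStruct L M d) → Prop}
    (hp : ∀ {α : Type} [Finite α] (s : (α → M) → Assignment (definableStruct L M d)),
      DefinableAssignments P Q s → IsUnionOfDefinable L A {v | p (s v)}) (n R : ℕ) [Finite α]
    {s : (α → M) → Assignment (definableStruct L M d)} (hs : DefinableAssignments P Q s) :
    IsUnionOfDefinable L A {v | ∃ B, p ((s v).updateRel n R B)} := by
  rintro v ⟨B, hB⟩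
  obtain ⟨m, θ, a, rfl⟩ := exists_fiber_eq B
  have hs' : DefinableAssignments P Q fun w : α ⊕ Fin m → M =>
      (s (w ∘ Sum.inl)).updateRel n R (fiber θ (w ∘ Sum.inr)) :=
    (hs.comp_right Sum.inl).updateRel n R ((definableFamily_fiber θ).comp_right Sum.inr)
  obtain ⟨T, hTp, hT, hvT⟩ := (hp _ hs').image_comp_inl v ⟨a, hB⟩
  exact ⟨T, fun v hv => (hTp hv).imp' (fiber θ) fun a ha => ha, hT, hvT⟩

variable (hd : UniformlyDefinable L M d) (hP : ∀ x, (P x).Finite) (hQ : ∀ n R, (Q n R).Finite)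
include hd hP hQ

theorem Term.exists_finite_definableFun_eval (t : Term) :
    ∃ A : Set M, A.Finite ∧ ∀ {α : Type} [Finite α]
      (s : (α → M) → Assignment (definableStruct L M d)), DefinableAssignments P Q s →
        A.DefinableFun L fun v => t.eval (s v) := by
  cases t with
  | obj x => exact ⟨P x, hP x, fun s hs => hs.obj x⟩
  | num X => exact ⟨Q 0 X, hQ 0 X, fun s hs => hd.definableFun (hs.rel 0 X)⟩

theorem Formula.IsArithmetical.exists_finite_definable_sat {φ : Formula} (hφ : φ.IsArithmetical) :
    ∃ A : Set M, A.Finite ∧ ∀ {α : Type} [Finite α]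
      (s : (α → M) → Assignment (definableStruct L M d)), DefinableAssignments P Q s →
        A.Definable L {v | φ.Sat (s v)} := by
  induction φ with
  | falsum => exact ⟨∅, finite_empty, fun _ _ => definable_empty⟩
  | eq t u =>
    obtain ⟨A, hA, ht⟩ := t.exists_finite_definableFun_eval hd hP hQ
    obtain ⟨B, hB, hu⟩ := u.exists_finite_definableFun_eval hd hP hQ
    exact ⟨A ∪ B, hA.union hB, fun s hs =>
      ((ht s hs).mono subset_union_left).ofPred_eq ((hu s hs).mono subset_union_right)⟩
  | relEq n R S =>
    refine ⟨Q n R ∪ Q n S, (hQ n R).union (hQ n S), fun s hs => ?_⟩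
    simp only [Formula.Sat, ← Subtype.coe_inj]
    exact DefinableFamily.definable_eq ((hs.rel n R).mono subset_union_left)
      ((hs.rel n S).mono subset_union_right)
  | mem n t R =>
    choose A hA ht using fun i => (t i).exists_finite_definableFun_eval hd hP hQ
    refine ⟨(⋃ i, A i) ∪ Q n R, (finite_iUnion hA).union (hQ n R), fun s hs => ?_⟩
    refine DefinableFamily.definable_mem ((hs.rel n R).mono subset_union_right)
      (fun i => (ht i s hs).mono ?_) fun i => DefinableFun.proj L
    exact (subset_iUnion A i).trans subset_union_left
  | imp φ ψ ihφ ihψ =>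
    obtain ⟨A, hA, hφA⟩ := ihφ hφ.1
    obtain ⟨B, hB, hψB⟩ := ihψ hφ.2
    exact ⟨A ∪ B, hA.union hB, fun s hs => definable_imp
      ((hφA s hs).mono subset_union_left) ((hψB s hs).mono subset_union_right)⟩
  | allObj x φ ih =>
    obtain ⟨A, hA, hφA⟩ := ih hφ
    exact ⟨A, hA, fun s hs => definable_forall
      (hφA _ ((hs.comp_right some).updateObj x none))⟩
  | exObj x φ ih =>
    obtain ⟨A, hA, hφA⟩ := ih hφ
    exact ⟨A, hA, fun s hs => definable_exists
      (hφA _ ((hs.comp_right some).updateObj x none))⟩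
  | allRel n R φ _ => exact hφ.elim
  | exRel n R φ _ => exact hφ.elim

theorem Formula.IsSigma11.exists_finite_isUnionOfDefinable {φ : Formula} (hφ : φ.IsSigma11) :
    ∃ A : Set M, A.Finite ∧ ∀ {α : Type} [Finite α]
      (s : (α → M) → Assignment (definableStruct L M d)), DefinableAssignments P Q s →
        IsUnionOfDefinable L A {v | φ.Sat (s v)} := by
  induction hφ with
  | arith hφ =>
    obtain ⟨A, hA, hφA⟩ := hφ.exists_finite_definable_sat hd hP hQ
    exact ⟨A, hA, fun s hs => .of_definable (hφA s hs)⟩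
  | exRel n R _ ih =>
    obtain ⟨A, hA, hφA⟩ := ih
    exact ⟨A, hA, fun s hs => isUnionOfDefinable_exists_rel hφA n R hs⟩

theorem Formula.IsPi11.exists_finite_isUnionOfDefinable_not {φ : Formula} (hφ : φ.IsPi11) :
    ∃ A : Set M, A.Finite ∧ ∀ {α : Type} [Finite α]
      (s : (α → M) → Assignment (definableStruct L M d)), DefinableAssignments P Q s →
        IsUnionOfDefinable L A {v | ¬ φ.Sat (s v)} := by
  induction hφ with
  | arith hφ =>
    obtain ⟨A, hA, hφA⟩ := hφ.exists_finite_definable_sat hd hP hQ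
    exact ⟨A, hA, fun s hs => .of_definable (hφA s hs).compl⟩
  | allRel n R _ ih =>
    obtain ⟨A, hA, hφA⟩ := ih
    refine ⟨A, hA, fun s hs => ?_⟩
    simp only [Formula.Sat, not_forall]
    exact isUnionOfDefinable_exists_rel (p := fun s => ¬ Formula.Sat _ s) hφA n R hs

end DefinableAssignments

theorem models_delta11Comprehension {L : Language} {M : Type*} [L.Structure M]
    {d : definableSets L M 1 → M} (hM : Saturated L M) (hd : UniformlyDefinable L M d) :
    (definableStruct L M d).Models delta11Comprehension := by
  rintro _ ⟨n, x, R, φ, ψ, hx, hφ, hψ, hφR, -, rfl⟩ s hiff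
  simp only [Formula.sat_allObjs hx, Formula.sat_iff] at hiff
  obtain ⟨P, Q, hP, hQ, hs⟩ := exists_definableAssignments_updateObjs s hx
  obtain ⟨A, hA, hφA⟩ := hφ.exists_finite_isUnionOfDefinable hd hP hQ
  obtain ⟨B, hB, hψB⟩ := hψ.exists_finite_isUnionOfDefinable_not hd hP hQ
  rw [Formula.sat_comprehension hx hφR]
  refine (hM.definable_of_isUnionOfDefinable (hA.union hB) ?_ ?_).mono (subset_univ _)
  · exact (hφA _ hs).mono subset_union_left
  · simp only [hiff]
    exact (hψB _ hs).mono subset_union_right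

/-- The formula `X = {x}`, with `z` as bound variable. -/
def eqSingleton (X x z : ℕ) : Formula :=
  .allObj z ((Formula.memVars ![z] X).iff (.eq (.obj z) (.obj x)))

section Consequences

variable {M : Type*} {N : Struct M}

theorem sat_eqSingleton {X x z : ℕ} (hxz : x ≠ z) (s : Assignment N) :
    (eqSingleton X x z).Sat s ↔ (s.rel 0 X).1 = {![s.obj x]} := by
  rw [Set.ext_iff, forall_fin_one_pi]
  refine forall_congr' fun a => ?_
  rw [Formula.sat_iff, Formula.sat_memVars_one]
  simp [Formula.Sat, Term.eval, Assignment.updateObj, hxz]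

theorem sat_eqSingleton_updateRel {X x z : ℕ} (hxz : x ≠ z) {s : Assignment N}
    (hs : {![s.obj x]} ∈ N.rel 0) (B : N.rel 0) :
    (eqSingleton X x z).Sat (s.updateRel 0 X B) ↔ B = ⟨{![s.obj x]}, hs⟩ := by
  rw [sat_eqSingleton hxz, Assignment.updateRel_rel_self]
  exact (Subtype.ext_iff (a2 := ⟨{![s.obj x]}, hs⟩)).symm

theorem sat_exRel_eqSingleton_and {X x z : ℕ} (hxz : x ≠ z) {s : Assignment N}
    (hs : {![s.obj x]} ∈ N.rel 0) {φ : Formula} :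
    (Formula.exRel 0 X ((eqSingleton X x z).and φ)).Sat s ↔
      φ.Sat (s.updateRel 0 X ⟨{![s.obj x]}, hs⟩) :=
  calc _ ↔ ∃ B : N.rel 0, B = ⟨{![s.obj x]}, hs⟩ ∧ φ.Sat (s.updateRel 0 X B) :=
        exists_congr fun B => by rw [Formula.sat_and, sat_eqSingleton_updateRel hxz hs]
    _ ↔ _ := exists_eq_left

theorem sat_allRel_eqSingleton_imp {X x z : ℕ} (hxz : x ≠ z) {s : Assignment N}
    (hs : {![s.obj x]} ∈ N.rel 0) {φ : Formula} :
    (Formula.allRel 0 X ((eqSingleton X x z).imp φ)).Sat s ↔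
      φ.Sat (s.updateRel 0 X ⟨{![s.obj x]}, hs⟩) :=
  calc _ ↔ ∀ B : N.rel 0, B = ⟨{![s.obj x]}, hs⟩ → φ.Sat (s.updateRel 0 X B) :=
        forall_congr' fun B => imp_congr_left (sat_eqSingleton_updateRel hxz hs B)
    _ ↔ _ := forall_eq

theorem isArithmetical_eqSingleton (X x z : ℕ) : (eqSingleton X x z).IsArithmetical :=
  ⟨⟨⟨trivial, trivial⟩, ⟨trivial, trivial⟩, trivial⟩, trivial⟩

theorem relFree_eqSingleton_iff {X x z n R : ℕ} :
    (eqSingleton X x z).RelFree n R ↔ n = 0 ∧ X = R := by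
  simp [eqSingleton, Formula.RelFree, Formula.not, Formula.and, Formula.iff, Formula.memVars,
    Term.HasSetVar, eq_comm]

theorem setOf_notMem_range_num_mem_rel [Nonempty (Assignment N)]
    (h : N.Models (comprehensionSchema Formula.IsPi11)) :
    {v : Fin 1 → M | v 0 ∉ range N.num} ∈ N.rel 0 := by
  let φ : Formula := .allRel 0 0 (Formula.eq (.num 0) (.obj 0)).not
  have hx : Function.Injective ![0] := Function.injective_of_subsingleton _
  have hR : ¬ φ.RelFree 0 1 := by simp [φ, Formula.RelFree, Formula.not, Term.HasSetVar]
  obtain ⟨s⟩ := ‹Nonempty (Assignment N)›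
  have hφ := h _ ⟨0, ![0], 1, φ, hx, .allRel 0 0 (.arith ⟨trivial, trivial⟩), hR, rfl⟩ s
  rw [Formula.sat_comprehension hx hR] at hφ
  convert! hφ using 1
  ext v
  rw [mem_ofPred_eq, mem_ofPred_eq, mem_range, not_exists]
  refine forall_congr' fun X => not_congr ?_
  change _ ↔ N.num _ = (s.updateObjs ![0] v).obj (![0] 0)
  rw [s.updateObjs_obj_apply hx, Assignment.updateRel_rel_self]

theorem setOf_num_singleton_eq_mem_rel [Nonempty (Assignment N)]
    (h : N.Models delta11Comprehension) (hN : ∀ v : Fin 1 → M, {v} ∈ N.rel 0) :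
    {v : Fin 2 → M | N.num ⟨{![v 0]}, hN _⟩ = v 1} ∈ N.rel 1 := by
  let φ : Formula := .exRel 0 0 ((eqSingleton 0 0 2).and (.eq (.num 0) (.obj 1)))
  let ψ : Formula := .allRel 0 0 ((eqSingleton 0 0 2).imp (.eq (.num 0) (.obj 1)))
  obtain ⟨s⟩ := ‹Nonempty (Assignment N)›
  have hx : Function.Injective ![0, 1] := by decide
  have hatom : (eqSingleton 0 0 2).IsArithmetical := isArithmetical_eqSingleton 0 0 2
  have hφ : φ.IsSigma11 := .exRel 0 0 (.arith ⟨⟨hatom, trivial, trivial⟩, trivial⟩)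
  have hψ : ψ.IsPi11 := .allRel 0 0 (.arith ⟨hatom, trivial⟩)
  have hφR : ¬ φ.RelFree 1 0 := by
    simp [φ, Formula.RelFree, Formula.not, Formula.and, relFree_eqSingleton_iff]
  have hψR : ¬ ψ.RelFree 1 0 := by
    simp [ψ, Formula.RelFree, relFree_eqSingleton_iff]
  have hsat (t : Assignment N) :
      (Formula.eq (.num 0) (.obj 1)).Sat (t.updateRel 0 0 ⟨{![t.obj 0]}, hN _⟩) ↔
        N.num ⟨{![t.obj 0]}, hN _⟩ = t.obj 1 := by
    change N.num _ = t.obj 1 ↔ _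
    rw [Assignment.updateRel_rel_self]
  have hsatφ (t : Assignment N) : φ.Sat t ↔ N.num ⟨{![t.obj 0]}, hN _⟩ = t.obj 1 :=
    (sat_exRel_eqSingleton_and (by decide) (hN _)).trans (hsat t)
  have hsatψ (t : Assignment N) : ψ.Sat t ↔ N.num ⟨{![t.obj 0]}, hN _⟩ = t.obj 1 :=
    (sat_allRel_eqSingleton_imp (by decide) (hN _)).trans (hsat t)
  have hcomp := h _ ⟨1, ![0, 1], 0, φ, ψ, hx, hφ, hψ, hφR, hψR, rfl⟩ s <|
    (Formula.sat_allObjs hx _ _).2 fun v =>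
      (Formula.sat_iff _ _ _).2 ((hsatφ _).trans (hsatψ _).symm)
  have hobj₀ (v : Fin 2 → M) : (s.updateObjs ![0, 1] v).obj 0 = v 0 :=
    s.updateObjs_obj_apply hx v 0
  have hobj₁ (v : Fin 2 → M) : (s.updateObjs ![0, 1] v).obj 1 = v 1 :=
    s.updateObjs_obj_apply hx v 1
  simpa only [Formula.sat_comprehension hx hφR, hsatφ, hobj₀, hobj₁] using hcomp

theorem exists_rel_of_models_sigma11Choice (h : N.Models sigma11Choice) {n m : ℕ}
    {x : Fin (n + 1) → ℕ} {y : Fin (m + 1) → ℕ} (hxy : Function.Injective (Fin.append x y))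
    {P R : ℕ} {φ : Formula} (hφ : φ.IsSigma11) (hR : ¬ φ.RelFree (n + 1 + m) R)
    (s : Assignment N) (hs : ∀ v, ∃ B, φ.Sat ((s.updateObjs x v).updateRel m P B)) :
    ∃ C ∈ N.rel (n + 1 + m), ∀ (v : Fin (n + 1) → M) (B : N.rel m),
      B.1 = {w : Fin (m + 1) → M | Fin.append v w ∈ C} →
        φ.Sat ((s.updateObjs x v).updateRel m P B) := by
  obtain ⟨hx, hy, -⟩ := Fin.append_injective_iff.1 hxy
  obtain ⟨C, hC⟩ := h _ ⟨n, m, x, y, P, R, φ, hxy, hφ, hR, rfl⟩ s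
    ((Formula.sat_allObjs hx _ _).2 hs)
  refine ⟨C.1, C.2, fun v B hB => ?_⟩
  have hφB := (Formula.sat_allObjs hx _ _).1 hC v B ((Formula.sat_allObjs hy _ _).2 fun w => ?_)
  · refine (φ.sat_congr (t := (s.updateObjs x v).updateRel m P B) ?_ fun i S hS => ?_).1 hφB
    · rfl
    by_cases hP : m = i ∧ P = S
    · obtain ⟨rfl, rfl⟩ := hP
      rw [Assignment.updateRel_rel_self, Assignment.updateRel_rel_self]
    · rw [Assignment.updateRel_rel_of_ne _ _ hP, Assignment.updateRel_rel_of_ne _ _ hP]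
      refine Assignment.updateRel_rel_of_ne _ _ ?_
      rintro ⟨rfl, rfl⟩
      exact hR hS
  · let t := (s.updateRel (n + 1 + m) R C).updateRel m P B
    change Formula.Sat _ ((t.updateObjs x v).updateObjs y w)
    have hPB : (t.rel m P).1 = B.1 := by rw [Assignment.updateRel_rel_self]
    have hRC : (t.rel (n + 1 + m) R).1 = C.1 := by
      rw [Assignment.updateRel_rel_of_ne _ _ (by omega), Assignment.updateRel_rel_self]
    rw [Formula.sat_iff, Formula.sat_memVars, Formula.sat_memVars,
      Assignment.updateObjs_obj_comp _ hy, t.updateObjs_append hxy,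
      Assignment.updateObjs_obj_comp _ hxy]
    change w ∈ (t.rel m P).1 ↔ Fin.append v w ∈ (t.rel (n + 1 + m) R).1
    rw [hPB, hRC, hB, mem_ofPred_eq]

end Consequences

section NegativeResults

variable {L : Language} {M : Type*} [L.Structure M]

theorem definable_append_fiber {m n : ℕ} {C : Set (Fin (m + n) → M)}
    (hC : (univ : Set M).Definable L C) (v : Fin m → M) :
    (univ : Set M).Definable L {w : Fin n → M | Fin.append v w ∈ C} := by
  refine Definable.preimage_map (Fin.addCases (fun i => ?_) fun i => ?_) hC
  · simpa only [Fin.append_left] using L.definableFun_const _ (mem_univ (v i))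
  · simpa only [Fin.append_right] using DefinableFun.proj L

variable [Nonempty M] {d : definableSets L M 1 → M}

instance : Nonempty (Assignment (definableStruct L M d)) :=
  ⟨⟨fun _ => Classical.arbitrary M, fun _ _ => ⟨∅, definable_empty⟩⟩⟩

theorem exists_definableFun_of_models_sigma11Choice
    (h : (definableStruct L M d).Models sigma11Choice) {E : Set (Fin 2 → M)}
    (hE : (univ : Set M).Definable L E) (htotal : ∀ a, ∃ b, ![a, b] ∈ E) :
    ∃ f : (Fin 1 → M) → M, (univ : Set M).DefinableFun L f ∧ ∀ v, ![v 0, f v] ∈ E := by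
  let φ : Formula := .exObj 2 ((Formula.memVars ![0, 2] 1).and (eqSingleton 0 2 1))
  obtain ⟨s⟩ : Nonempty (Assignment (definableStruct L M d)) := inferInstance
  have hφ (v : Fin 1 → M) (B : definableSets L M 1) :
      φ.Sat (((s.updateRel 1 1 ⟨E, hE⟩).updateObjs ![0] v).updateRel 0 0 B) ↔
        ∃ b, ![v 0, b] ∈ E ∧ B.1 = {![b]} := by
    refine exists_congr fun b => ?_
    rw [Formula.sat_and, Formula.sat_memVars_two, sat_eqSingleton (by decide)]
    change ![(s.updateObjs ![0] v).obj (![0] 0), b] ∈ E ∧ B.1 = {![b]} ↔ _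
    rw [s.updateObjs_obj_apply (Function.injective_of_subsingleton _)]
  have hφ' : φ.IsSigma11 := .arith ⟨⟨trivial, isArithmetical_eqSingleton 0 2 1, trivial⟩, trivial⟩
  have hR : ¬ φ.RelFree 1 0 := by
    simp [φ, Formula.RelFree, Formula.not, Formula.and, Formula.memVars, relFree_eqSingleton_iff]
  obtain ⟨C, hC, hCE⟩ := exists_rel_of_models_sigma11Choice h (x := ![0]) (y := ![1]) (P := 0)
    (R := 0) (by decide) hφ' hR (s.updateRel 1 1 ⟨E, hE⟩) fun v => by
      obtain ⟨b, hb⟩ := htotal (v 0)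
      exact ⟨⟨{![b]}, definable_of_finite (finite_singleton _)⟩, (hφ v _).2 ⟨b, hb, rfl⟩⟩
  choose f hfE hfC using fun v => (hφ v _).1 (hCE v ⟨_, definable_append_fiber hC v⟩ rfl)
  have hgraph : Function.tupleGraph f =
      {w : Option (Fin 1) → M |
        w ∘ Fin.append (fun _ : Fin 1 => some 0) (fun _ : Fin 1 => none) ∈ C} := by
    ext w
    have happend : w ∘ Fin.append (fun _ : Fin 1 => some 0) (fun _ : Fin 1 => none) =
        Fin.append (w ∘ some) ![w none] := by
      funext i
      fin_cases i <;> rfl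
    change f (w ∘ some) = w none ↔ _ ∈ C
    rw [happend]
    refine Iff.trans ?_ (Set.ext_iff.1 (hfC (w ∘ some)) ![w none]).symm
    rw [mem_singleton_iff, Matrix.vecCons_inj, and_iff_left rfl, eq_comm]
  refine ⟨f, ?_, hfE⟩
  rw [DefinableFun, hgraph]
  exact Definable.preimage_comp _ hC

theorem definableFun_num_singleton_of_models_delta11Comprehension
    (h : (definableStruct L M d).Models delta11Comprehension) :
    (univ : Set M).DefinableFun L fun v : Fin 1 → M =>
      d ⟨{v}, definable_of_finite (finite_singleton v)⟩ := by
  let single (v : Fin 1 → M) : definableSets L M 1 :=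
    ⟨{v}, definable_of_finite (finite_singleton v)⟩
  have hrel : (univ : Set M).Definable L {v : Fin 2 → M | d (single ![v 0]) = v 1} :=
    setOf_num_singleton_eq_mem_rel h fun v => (single v).2
  have hgraph : Function.tupleGraph (fun v => d (single v)) =
      {w : Option (Fin 1) → M | w ∘ ![some 0, none] ∈ {v | d (single ![v 0]) = v 1}} := by
    ext w
    have hw : ![w (some 0)] = w ∘ some := funext (Fin.forall_fin_one.2 rfl)
    change d (single (w ∘ some)) = w none ↔ d (single ![w (some 0)]) = w none
    rw [hw]
  rw [DefinableFun, hgraph]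
  exact hrel.preimage_comp _

theorem not_models_delta11BL (hM : IsDefinablyDedekindFinite L M) :
    ¬ (definableStruct L M d).Models Delta11BL := by
  intro h
  obtain ⟨s⟩ : Nonempty (Assignment (definableStruct L M d)) := inferInstance
  have hd : Function.Injective d := fun X Y hXY =>
    ((Formula.sat_iff _ _ _).1 (h basicLawV (.inl rfl) s X Y)).1 hXY
  have hsing := definableFun_num_singleton_of_models_delta11Comprehension fun χ hχ => h χ (.inr hχ)
  obtain ⟨v, hv⟩ := hM 1 _ (fun _ => hsing) (fun v w hvw =>
    singleton_injective (congrArg Subtype.val (hd (congrFun hvw 0))))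
    fun _ => d ⟨∅, definable_empty⟩
  exact singleton_ne_empty v (congrArg Subtype.val (hd (congrFun hv 0)))

theorem not_models_pi11HP {K : Type*} [L.Structure K] [DivisionRing K] [CharZero K]
    (hK : IsMinimal L K) :
    ¬ (definableStruct L K fun X => ((numerosity X.1 : ℤ) : K)).Models Pi11HP := by
  intro h
  let num (X : definableSets L K 1) : K := (numerosity X.1 : ℤ)
  have hrange : (univ : Set K).Definable L {v : Fin 1 → K | v 0 ∈ range num} := by
    rw [← compl_compl {v : Fin 1 → K | v 0 ∈ range num}]
    exact Definable.compl (setOf_notMem_range_num_mem_rel fun χ hχ => h χ (.inr hχ))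
  refine hK.not_definable_of_range_natCast_subset ?_ ?_ hrange
  · rintro _ ⟨n, rfl⟩
    obtain ⟨X, hX⟩ := exists_numerosity_eq_natCast (M := K) L n
    exact ⟨X, (congrArg Int.cast hX).trans (Int.cast_natCast n)⟩
  · rintro _ ⟨X, rfl⟩
    exact ⟨numerosity X.1, rfl⟩

open FirstOrder.Ring in
theorem not_models_sigma11PH {K : Type*} [Field K] [IsAlgClosed K] [CompatibleRing K]
    (hK : IsMinimal ring K) (h2 : (2 : K) ≠ 0) {d : definableSets ring K 1 → K} :
    ¬ (definableStruct ring K d).Models Sigma11PH := by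
  intro h
  have hE : (univ : Set K).Definable ring {v : Fin 2 → K | v 1 * v 1 = v 0} :=
    (definableFun_mul (.proj ring) (.proj ring)).ofPred_eq (.proj ring)
  obtain ⟨f, hf, hsq⟩ := exists_definableFun_of_models_sigma11Choice
    (fun χ hχ => h χ (.inr hχ)) hE fun a => by
      obtain ⟨b, hb⟩ := IsAlgClosed.exists_eq_mul_self a
      exact ⟨b, hb.symm⟩
  obtain ⟨v, hv⟩ := hK.exists_mul_self_ne_of_definableFun h2 hf
  exact hv (hsq v)

end NegativeResults

end SecondOrder

theorem mainTheorem6 {k : Type u} [Field k] [IsAlgClosed k] [CharZero k]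
    [FirstOrder.Ring.CompatibleRing k]
    (hk : ModelTheoretic.Saturated FirstOrder.Language.ring k) :
    (∃ num : ModelTheoretic.definableSets FirstOrder.Language.ring k 1 → k,
      (∀ X : ModelTheoretic.definableSets FirstOrder.Language.ring k 1,
        (X.1.Finite ∧ num X = (X.1.ncard : k)) ∨
          (X.1ᶜ.Finite ∧ num X = -((X.1ᶜ.ncard : k) + 1))) ∧
      ModelTheoretic.UniformlyDefinable FirstOrder.Language.ring k num ∧
      (SecondOrder.definableStruct FirstOrder.Language.ring k num).Models
        SecondOrder.Delta11HP ∧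
      ¬ (SecondOrder.definableStruct FirstOrder.Language.ring k num).Models
        SecondOrder.Sigma11PH ∧
      ¬ (SecondOrder.definableStruct FirstOrder.Language.ring k num).Models
        SecondOrder.Pi11HP) ∧
    ¬ ∃ d : ModelTheoretic.definableSets FirstOrder.Language.ring k 1 → k,
      (SecondOrder.definableStruct FirstOrder.Language.ring k d).Models
        SecondOrder.Delta11BL := by
  have hmin : ModelTheoretic.IsMinimal FirstOrder.Language.ring k := hk.isMinimal
  have hfin : ModelTheoretic.IsDefinablyDedekindFinite FirstOrder.Language.ring k :=
    ModelTheoretic.isDefinablyDedekindFinite_of_isAlgClosed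
  have : Infinite k := IsAlgClosed.instInfinite
  have hunif := hk.uniformlyDefinable_numerosity hmin (c := Int.cast) fun z =>
    ModelTheoretic.definableFun_const_of_mem_closure (intCast_mem _ z)
  refine ⟨⟨fun X => (ModelTheoretic.numerosity X.1 : ℤ), fun X => ?_, ?_, ?_, ?_, ?_⟩, ?_⟩
  · exact (hmin _ X.2).imp
      (fun h => ⟨h, by simp [ModelTheoretic.numerosity_of_finite h]⟩)
      (fun h => ⟨h, by simp only [ModelTheoretic.numerosity_of_finite_compl h]; push_cast; rfl⟩)
  · exact hunif
  · exact fun φ hφ => hφ.elim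
      (SecondOrder.models_humesPrinciple hmin hfin Int.cast_injective φ)
      (SecondOrder.models_delta11Comprehension hk hunif φ)
  · exact SecondOrder.not_models_sigma11PH hmin two_ne_zero
  · exact SecondOrder.not_models_pi11HP hmin
  · exact fun ⟨_, h⟩ => SecondOrder.not_models_delta11BL hfin h
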